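/- Let $d \ge 2$ and let $(\mathcal U_\lambda)_{\lambda\in[0,1]}$ be a family of closed subsets of the Euclidean space $\mathbb R^d$ such that $\mathcal U_{\lambda_1}\subseteq \mathcal U_{\lambda_2}$ whenever $0\le\lambda_1\le\lambda_2\le 1$, and such that $\mathcal U_q\neq\emptyset$ for some $q\in[0,1)$. Suppose that for every $\lambda\in[0,1)$, $\psi\in(0,1-\lambda)$ and $\eta\in(0,1)$ there exists $\delta_1=\delta_1(\lambda,\psi,\eta)>0$ such that, whenever $x\in\mathcal U_\lambda$, $\delta\in(0,\delta_1)$ and $v_1,v_2,v_3$ are in the closed unit ball of $\mathbb R^d$, there exist $v_1',v_2',v_3'\in\mathbb R^d$ with $\|v_i'-v_i\|\le\eta$ for $i=1,2,3$ and $$[x+\delta v_1',\,x+\delta v_3']\cup[x+\delta v_3',\,x+\delta v_2']\subseteq\mathcal U_{\lambda+\psi},$$ where $[a,b]$ denotes the closed line segment from $a$ to $b$. Then the set $$S=\overline{\bigcup_{0\le q<1}\mathcal U_q}$$ is a universal differentiability set, that is, every Lipschitz function $g:\mathbb R^d\to\mathbb R$ is (Fréchet) differentiable at some point of $S$. Moreover,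 whenever $y\in S$, $\rho>0$ and $g:\mathbb R^d\to\mathbb R$ is a Lipschitz function, there exists $x\in S$ such that $\|x-y\|<\rho$ and $g$ is differentiable at $x$. -/

import Mathlib

/-- A set `S ⊆ E` is a universal differentiability set if every Lipschitz function `g : E → ℝ`
is (Fréchet) differentiable at some point of `S`. -/
def IsUniversalDifferentiabilitySet {E : Type*} [NormedAddCommGroup E] [NormedSpace ℝ E]
    (S : Set E) : Prop :=
  ∀ g : E → ℝ, (∃ L : NNReal, LipschitzWith L g) → ∃ x ∈ S, DifferentiableAt ℝ g x

open MeasureTheory Set Metric Filter Topology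
open scoped NNReal ENNReal RealInnerProductSpace

/-! The argument is in the style of Preiss: a directional derivative that is almost locally maximal,
among pairs with suitably controlled increments, forces Fréchet differentiability.

Let `P` be the derivative of `F` at `x` along the unit vector `e`, and suppose that `F` is not
differentiable at `x`. For arbitrarily small `h`, `F (x + h)` then misses `F x + P ⟪h, e⟫` by more
than `ε ‖h‖`. Take `s = ‖h‖ / κ` with `κ` small and travel from `x - s e` through `x + h` to `x + s
e`. Along this wedge `F` minus its part of slope `P` nearly vanishes at both ends but has size at
least about `ε κ s` at the vertex, so somewhere it climbs with derivative of order `ε κ`. Tilting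
the path by `κ` changes the speed only by order `κ²`, hence a unit direction with derivative larger
than `P` survives. The wedge hypothesis moves the path into a slightly larger set of the family
without spoiling this, contradicting maximality
(`LipschitzWith.differentiableAt_of_almost_maximal`). Competitors must have increments along `e`
within a multiple of `√(P' - P) |t|` of slope `P`; a maximal-slope estimate in one variable provides
such points (`LipschitzWith.exists_deriv_ge_and_increments_le`).

Almost maximal pairs come from an iteration (`Stage.Good.exists_almost_maximal`). Each stage adds `σ
⟪e, ·⟫` to the function, which penalizes directions away from the current `e`, and then almost
maximizes again with `σ` divided by 4. Candidates are nested, so points, directions and slopes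
converge. Lower indices increase and upper indices decrease strictly: closedness puts the limit in
`U l`, with room left above `l`. The accumulated perturbation is linear and does not affect
differentiability. -/

/-! ### Maximal slopes of Lipschitz functions of one variable -/

theorem LipschitzWith.integral_deriv_eq_sub {M : ℝ≥0} {φ : ℝ → ℝ} (hφ : LipschitzWith M φ)
    (a b : ℝ) : ∫ t in a..b, deriv φ t = φ b - φ a :=
  (hφ.lipschitzOnWith.absolutelyContinuousOnInterval).integral_deriv_eq_sub

theorem LipschitzWith.ofReal_abs_sub_le_lintegral_deriv {M : ℝ≥0} {φ : ℝ → ℝ}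
    (hφ : LipschitzWith M φ) (a b : ℝ) :
    ENNReal.ofReal |φ b - φ a| ≤ ∫⁻ t in uIoc a b, ‖deriv φ t‖ₑ := by
  rw [← hφ.integral_deriv_eq_sub, ← Real.norm_eq_abs,
    intervalIntegral.norm_integral_eq_norm_integral_uIoc, ofReal_norm]
  exact enorm_integral_le_lintegral_enorm _

/-- Weak-type estimate for the maximal slope of a Lipschitz function of one variable. -/
theorem LipschitzWith.volume_le_of_forall_exists_steep {M : ℝ≥0} {φ : ℝ → ℝ}
    (hφ : LipschitzWith M φ) (hfin : ∫⁻ t, ‖deriv φ t‖ₑ ≠ ∞) {c : ℝ} (hc : 0 < c) {S : Set ℝ}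
    (hS : ∀ τ ∈ S, ∃ t, c * |t| < |φ (τ + t) - φ τ|) :
    volume S ≤ ENNReal.ofReal (5 / c) * ∫⁻ t, ‖deriv φ t‖ₑ := by
  choose! t ht using hS
  have htpos : ∀ τ ∈ S, 0 < |t τ| := by
    intro τ hτ
    rcases eq_or_ne (t τ) 0 with h | h
    · have := ht τ hτ
      simp [h] at this
    · exact abs_pos.2 h
  have hsub : ∀ τ, uIoc τ (τ + t τ) ⊆ closedBall (τ + t τ / 2) (|t τ| / 2) := by
    intro τ y hy
    rw [mem_closedBall, Real.dist_eq]
    rw [uIoc, mem_Ioc] at hy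
    rcases le_total 0 (t τ) with h | h
    · rw [min_eq_left (by linarith), max_eq_right (by linarith)] at hy
      rw [abs_of_nonneg h, abs_le]; constructor <;> linarith [hy.1, hy.2]
    · rw [min_eq_right (by linarith), max_eq_left (by linarith)] at hy
      rw [abs_of_nonpos h, abs_le]; constructor <;> linarith [hy.1, hy.2]
  have hball : ∀ τ ∈ S, ENNReal.ofReal (c * |t τ|) ≤
      ∫⁻ y in closedBall (τ + t τ / 2) (|t τ| / 2), ‖deriv φ y‖ₑ := fun τ hτ =>
    (ENNReal.ofReal_le_ofReal (ht τ hτ).le).trans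
      ((hφ.ofReal_abs_sub_le_lintegral_deriv _ _).trans (lintegral_mono_set (hsub τ)))
  -- A slope above `c` over length `|t|` uses up at least `c |t|` of the finite integral of `|φ'|`;
  -- this bounds the radii, as Vitali's lemma requires.
  have hR : ∀ τ ∈ S, |t τ| / 2 ≤ (∫⁻ t, ‖deriv φ t‖ₑ).toReal / c := by
    intro τ hτ
    have h1 := (hball τ hτ).trans (setLIntegral_le_lintegral _ _)
    have h2 := (ENNReal.ofReal_le_iff_le_toReal hfin).1 h1
    rw [le_div_iff₀ hc]
    nlinarith [htpos τ hτ]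
  obtain ⟨u, huS, hdisj, hcov⟩ := Vitali.exists_disjoint_subfamily_covering_enlargement_closedBall
    S (fun τ => τ + t τ / 2) (fun τ => |t τ| / 2) _ hR 5 (by norm_num)
  have hucount : u.Countable := by
    refine hdisj.countable_of_nonempty_interior fun τ hτ => ?_
    rw [interior_closedBall _ (by have := htpos τ (huS hτ); positivity)]
    exact nonempty_ball.2 (by have := htpos τ (huS hτ); positivity)
  have hScov : S ⊆ ⋃ b ∈ u, closedBall (b + t b / 2) (5 * (|t b| / 2)) := by
    intro τ hτ
    obtain ⟨b, hb, hsubb⟩ := hcov τ hτ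
    refine mem_biUnion hb (hsubb ?_)
    rw [mem_closedBall, Real.dist_eq, show τ - (τ + t τ / 2) = -(t τ / 2) by ring, abs_neg,
      abs_div, abs_two]
  have := hucount.to_subtype
  calc volume S ≤ volume (⋃ b ∈ u, closedBall (b + t b / 2) (5 * (|t b| / 2))) :=
        measure_mono hScov
    _ ≤ ∑' b : u, volume (closedBall ((b : ℝ) + t b / 2) (5 * (|t b| / 2))) :=
        measure_biUnion_le _ hucount _
    _ ≤ ∑' b : u, ENNReal.ofReal (5 / c) *
          ∫⁻ y in closedBall ((b : ℝ) + t b / 2) (|t b| / 2), ‖deriv φ y‖ₑ := by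
        refine ENNReal.tsum_le_tsum fun b => ?_
        refine le_trans (le_of_eq ?_) (mul_le_mul_right (hball b (huS b.2)) _)
        rw [Real.volume_closedBall, ← ENNReal.ofReal_mul (by positivity)]
        congr 1
        field_simp
    _ = ENNReal.ofReal (5 / c) *
          ∫⁻ y in ⋃ b ∈ u, closedBall (b + t b / 2) (|t b| / 2), ‖deriv φ y‖ₑ := by
        rw [ENNReal.tsum_mul_left, lintegral_biUnion hucount
          (fun _ _ => isClosed_closedBall.measurableSet) hdisj]
    _ ≤ _ := mul_le_mul_right (setLIntegral_le_lintegral _ _) _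

/-- Serves the layer-cake integration of the weak-type bound at slope proportional to `√l`; the
singularity at 0 is integrable. -/
theorem lintegral_Ioc_const_div_sqrt {c M : ℝ} (hc : 0 ≤ c) (hM : 0 ≤ M) :
    ∫⁻ l in Ioc 0 M, ENNReal.ofReal (c / √l) = ENNReal.ofReal (2 * c * √M) := by
  have hI : IntervalIntegrable (fun l : ℝ => l ^ (-(1 / 2) : ℝ)) volume 0 M :=
    intervalIntegral.intervalIntegrable_rpow' (by norm_num)
  have hI' : IntegrableOn (fun l : ℝ => c * l ^ (-(1 / 2) : ℝ)) (Ioc 0 M) :=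
    ((intervalIntegrable_iff_integrableOn_Ioc_of_le hM).1 hI).const_mul c
  have hcongr : ∀ l ∈ Ioc 0 M, ENNReal.ofReal (c / √l) =
      ENNReal.ofReal (c * l ^ (-(1 / 2) : ℝ)) := by
    intro l hl
    rw [Real.rpow_neg hl.1.le, ← Real.sqrt_eq_rpow, div_eq_mul_inv]
  rw [setLIntegral_congr_fun measurableSet_Ioc hcongr, ← ofReal_integral_eq_lintegral_ofReal hI',
    ← intervalIntegral.integral_of_le hM, intervalIntegral.integral_const_mul,
    integral_rpow (Or.inl (by norm_num))]
  · congr 1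
    rw [show (-(1 / 2) : ℝ) + 1 = 1 / 2 by norm_num, ← Real.sqrt_eq_rpow,
      Real.zero_rpow (by norm_num)]
    ring
  · filter_upwards [ae_restrict_mem measurableSet_Ioc] with l hl
    have := hl.1
    simp only [Pi.zero_apply]
    positivity

theorem deriv_eq_zero_of_const_outside {φ : ℝ → ℝ} {s : ℝ}
    (hleft : ∀ t ≤ -s, φ t = φ (-s)) (hright : ∀ t, s ≤ t → φ t = φ s)
    {t : ℝ} (ht : t ∉ Icc (-s) s) : deriv φ t = 0 := by
  rw [mem_Icc, not_and_or, not_le, not_le] at ht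
  rcases ht with ht | ht
  · have : φ =ᶠ[nhds t] fun _ => φ (-s) := by
      filter_upwards [Iio_mem_nhds ht] with y hy using hleft y hy.le
    rw [this.deriv_eq, deriv_const]
  · have : φ =ᶠ[nhds t] fun _ => φ s := by
      filter_upwards [Ioi_mem_nhds ht] with y hy using hright y hy.le
    rw [this.deriv_eq, deriv_const]

/-- A Lipschitz function that makes a detour over `[-s, s]` has, outside any small exceptional
set, a point with large derivative at which all increments are controlled by the square root of
that derivative. -/
theorem LipschitzWith.exists_deriv_ge_and_increments_le {M : ℝ≥0} {φ : ℝ → ℝ}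
    (hφ : LipschitzWith M φ) (hM : 0 < M) {s g ξ : ℝ} (hs : 0 < s) (hg : 0 < g)
    (hleft : ∀ t ≤ -s, φ t = φ (-s)) (hright : ∀ t, s ≤ t → φ t = φ s)
    (hξ : ξ ∈ Icc (-s) s) (hdet : g * s ≤ |φ ξ - φ (-s)|)
    (hends : |φ s - φ (-s)| ≤ |φ ξ - φ (-s)| / 2) {N : Set ℝ} (hNm : MeasurableSet N)
    (hN : volume N ≤ ENNReal.ofReal (g * s / (16 * M))) :
    ∃ τ ∈ Ioo (-s) s \ N, DifferentiableAt ℝ φ τ ∧ g / 8 ≤ deriv φ τ ∧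
      ∀ t, |φ (τ + t) - φ τ| ≤ 120 * √M * √(deriv φ τ) * |t| := by
  have hM' : (0 : ℝ) < M := hM
  set h := deriv φ with hh
  have hmeas : Measurable h := measurable_deriv φ
  have hbound : ∀ t, |h t| ≤ M := fun t => norm_deriv_le_of_lipschitz hφ
  have hzero : ∀ t ∉ Icc (-s) s, h t = 0 := fun t ht =>
    deriv_eq_zero_of_const_outside hleft hright ht
  have h_integrable : Integrable h := by
    have : IntegrableOn h (Icc (-s) s) :=
      Measure.integrableOn_of_bounded (M := M) (by simp) hmeas.aestronglyMeasurable
        (Filter.Eventually.of_forall hbound)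
    exact this.integrable_of_forall_notMem_eq_zero hzero
  have hpos_int : Integrable (fun t => max (h t) 0) := h_integrable.pos_part
  have habs_int : Integrable (fun t => |h t|) := h_integrable.abs
  set I := ∫ t, max (h t) 0 with hI
  have htotal : ∫ t, h t = φ s - φ (-s) := by
    rw [← hφ.integral_deriv_eq_sub, intervalIntegral.integral_of_le (by linarith),
      ← integral_Icc_eq_integral_Ioc, setIntegral_eq_integral_of_forall_compl_eq_zero hzero]
  have habs : ∫ t, |h t| = 2 * I - (φ s - φ (-s)) := by
    rw [← htotal, hI, ← integral_const_mul, ← integral_sub (hpos_int.const_mul 2) h_integrable]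
    refine integral_congr_ae (Filter.Eventually.of_forall fun t => ?_)
    rcases le_total 0 (h t) with h0 | h0
    · simp only [abs_of_nonneg h0, max_eq_left h0]; ring
    · simp only [abs_of_nonpos h0, max_eq_right h0]; ring
  have hpart : φ ξ - φ (-s) = ∫ t in Ioc (-s) ξ, h t := by
    rw [← hφ.integral_deriv_eq_sub, intervalIntegral.integral_of_le hξ.1]
  have hup : φ ξ - φ (-s) ≤ I := by
    rw [hpart]
    refine (setIntegral_mono h_integrable.integrableOn hpos_int.integrableOn fun t => le_max_left _ _).trans
      (setIntegral_le_integral hpos_int (Filter.Eventually.of_forall fun t => le_max_right _ _))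
  have hdown : -(φ ξ - φ (-s)) ≤ I - (φ s - φ (-s)) := by
    have hneg_int : Integrable (fun t => max (h t) 0 - h t) := hpos_int.sub h_integrable
    have : I - (φ s - φ (-s)) = ∫ t, (max (h t) 0 - h t) := by
      rw [← htotal, integral_sub hpos_int h_integrable]
    rw [this, hpart, ← integral_neg]
    refine (setIntegral_mono h_integrable.neg.integrableOn hneg_int.integrableOn fun t => ?_).trans
      (setIntegral_le_integral hneg_int (Filter.Eventually.of_forall fun t => ?_))
    · have := le_max_right (h t) 0
      simp only [Pi.neg_apply]; linarith
    · have := le_max_left (h t) 0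
      simp only [Pi.zero_apply]; linarith
  have hgs : 0 < g * s := mul_pos hg hs
  -- If the detour goes up, the climb precedes `ξ`. If it goes down, at least half of it must be
  -- climbed back by time `s`.
  have hIge : |φ ξ - φ (-s)| / 2 ≤ I := by
    have h1 := abs_le.1 hends
    have h2 := abs_nonneg (φ ξ - φ (-s))
    rcases abs_cases (φ ξ - φ (-s)) with h | h <;> rw [h.1] at h1 h2 ⊢ <;> linarith [h1.1, h1.2]
  have hIpos : 0 < I := by linarith
  have habsle : ∫ t, |h t| ≤ 3 * I := by
    rw [habs]; linarith [(abs_le.1 hends).1]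
  have hlint : ∫⁻ t, ‖h t‖ₑ ≤ ENNReal.ofReal (3 * I) := by
    have : ∫⁻ t, ‖h t‖ₑ = ENNReal.ofReal (∫ t, |h t|) := by
      rw [ofReal_integral_eq_lintegral_ofReal habs_int
        (Filter.Eventually.of_forall fun t => abs_nonneg _)]
      refine lintegral_congr fun t => ?_
      rw [← ofReal_norm, Real.norm_eq_abs]
    rw [this]
    exact ENNReal.ofReal_le_ofReal habsle
  by_contra hcon
  push Not at hcon
  -- Were the claim false, every point of `T` would have an increment of slope above `120 √M √h`.
  -- The weak-type estimate then bounds `{l < u}` by `5 / (120 √M √l) * 3 I = I / (8 √M √l)`, and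
  -- integrating over `(0, M]` gives `I / 4`.
  set T : Set ℝ := {τ | τ ∈ Ioo (-s) s ∧ τ ∉ N ∧ DifferentiableAt ℝ φ τ ∧ g / 8 ≤ h τ} with hT
  have hTm : MeasurableSet T :=
    measurableSet_Ioo.inter (hNm.compl.inter ((measurableSet_of_differentiableAt ℝ φ).inter
      (measurableSet_le measurable_const hmeas)))
  set u : ℝ → ℝ := T.indicator h with hu
  have hu_nonneg : ∀ t, 0 ≤ u t := fun t => by
    refine indicator_nonneg (s := T) (f := h) (fun τ hτ => ?_) t
    have : g / 8 ≤ h τ := hτ.2.2.2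
    linarith
  have hu_int : Integrable u := h_integrable.indicator hTm
  have hlevel : ∀ l ∈ Ioi (0 : ℝ), volume {t | l < u t} ≤
      (Ioc (0 : ℝ) M).indicator (fun l => ENNReal.ofReal ((I / (8 * √M)) / √l)) l := by
    intro l hl
    have hl0 : 0 < l := hl
    by_cases hlM : l ≤ M
    · rw [indicator_of_mem (show l ∈ Ioc (0 : ℝ) M from ⟨hl0, hlM⟩)]
      have hsl := Real.sqrt_pos.2 hl0
      have hsM := Real.sqrt_pos.2 hM'
      have := hφ.volume_le_of_forall_exists_steep (hlint.trans_lt ENNReal.ofReal_lt_top).ne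
        (c := 120 * √M * √l) (by positivity) (S := {t | l < u t}) (by
          intro τ hτ
          have hτT : τ ∈ T := by
            by_contra hne
            rw [mem_ofPred_eq, hu, indicator_of_notMem hne] at hτ
            linarith
          rw [mem_ofPred_eq, hu, indicator_of_mem hτT] at hτ
          obtain ⟨t, ht⟩ := hcon τ ⟨hτT.1, hτT.2.1⟩ hτT.2.2.1 hτT.2.2.2
          refine ⟨t, lt_of_le_of_lt ?_ ht⟩
          have := Real.sqrt_le_sqrt hτ.le
          gcongr)
      refine this.trans ((mul_le_mul_right hlint _).trans ?_)
      rw [← ENNReal.ofReal_mul (by positivity)]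
      refine ENNReal.ofReal_le_ofReal (le_of_eq ?_)
      field_simp
      norm_num
    · have : {t | l < u t} = ∅ := by
        refine eq_empty_of_forall_notMem fun t ht => ?_
        have h1 : u t ≤ M := by
          by_cases htT : t ∈ T
          · rw [hu, indicator_of_mem htT]; exact (le_abs_self _).trans (hbound t)
          · rw [hu, indicator_of_notMem htT]; exact hM'.le
        rw [mem_ofPred_eq] at ht
        linarith
      rw [this, measure_empty]
      exact zero_le
  have hu_le : ∫ t, u t ≤ I / 4 := by
    have h1 : ENNReal.ofReal (∫ t, u t) ≤ ENNReal.ofReal (I / 4) := by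
      rw [ofReal_integral_eq_lintegral_ofReal hu_int (Filter.Eventually.of_forall hu_nonneg),
        lintegral_eq_lintegral_meas_lt _ (Filter.Eventually.of_forall hu_nonneg)
          hu_int.aemeasurable]
      calc ∫⁻ l in Ioi 0, volume {t | l < u t}
          ≤ ∫⁻ l in Ioi 0, (Ioc (0 : ℝ) M).indicator
              (fun l => ENNReal.ofReal ((I / (8 * √M)) / √l)) l :=
            setLIntegral_mono' measurableSet_Ioi hlevel
        _ ≤ ∫⁻ l, (Ioc (0 : ℝ) M).indicator
              (fun l => ENNReal.ofReal ((I / (8 * √M)) / √l)) l := setLIntegral_le_lintegral _ _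
        _ = ENNReal.ofReal (2 * (I / (8 * √M)) * √M) := by
            rw [lintegral_indicator measurableSet_Ioc,
              lintegral_Ioc_const_div_sqrt (by positivity) hM'.le]
        _ = ENNReal.ofReal (I / 4) := by
            congr 1
            have hsM := Real.sqrt_pos.2 hM'
            field_simp
            norm_num
    exact (ENNReal.ofReal_le_ofReal_iff (by positivity)).1 h1
  have hNfin : volume N ≠ ∞ := (hN.trans_lt ENNReal.ofReal_lt_top).ne
  have hNreal : volume.real N ≤ g * s / (16 * M) :=
    ENNReal.toReal_le_of_le_ofReal (by positivity) hN
  have i1 : Integrable ((Icc (-s) s).indicator fun _ : ℝ => g / 8) :=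
    (integrable_indicator_iff measurableSet_Icc).2 (integrableOn_const (by simp))
  have i2 : Integrable (N.indicator fun _ : ℝ => (M : ℝ)) :=
    (integrable_indicator_iff hNm).2 (integrableOn_const hNfin)
  have hae : ∀ᵐ t, max (h t) 0 ≤ u t + (Icc (-s) s).indicator (fun _ => g / 8) t +
      N.indicator (fun _ => (M : ℝ)) t := by
    have hnull : ∀ᵐ t : ℝ, t ≠ -s ∧ t ≠ s := by
      have h1 : ∀ᵐ t : ℝ, t ≠ -s := by simp [ae_iff]
      have h2 : ∀ᵐ t : ℝ, t ≠ s := by simp [ae_iff]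
      exact h1.and h2
    filter_upwards [hφ.ae_differentiableAt_real, hnull] with t hd hne
    have hu0 := hu_nonneg t
    have hi1 : 0 ≤ (Icc (-s) s).indicator (fun _ => g / 8) t :=
      indicator_nonneg (fun _ _ => by positivity) t
    have hi2 : 0 ≤ N.indicator (fun _ => (M : ℝ)) t := indicator_nonneg (fun _ _ => hM'.le) t
    by_cases htI : t ∈ Icc (-s) s
    · by_cases htN : t ∈ N
      · rw [indicator_of_mem htN]
        have : max (h t) 0 ≤ M := max_le ((le_abs_self _).trans (hbound t)) hM'.le
        linarith
      · rw [indicator_of_mem htI] at hi1 ⊢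
        by_cases hlarge : g / 8 ≤ h t
        · have : t ∈ T := ⟨⟨lt_of_le_of_ne htI.1 hne.1.symm, lt_of_le_of_ne htI.2 hne.2⟩,
            htN, hd, hlarge⟩
          rw [hu, indicator_of_mem this, max_eq_left (by linarith)]
          linarith
        · have : max (h t) 0 ≤ g / 8 := max_le (by linarith) (by linarith)
          linarith
    · rw [hzero t htI, max_self]
      linarith
  -- The positive part of `h` is split over `T`, the points with `h < g / 8`, and `N`. As `g s ≤ 2
  -- I`, the three shares are at most `I / 4`, `I / 2` and `I / 8`, which cannot add up to `I`.
  have hfinal : I ≤ I / 4 + 2 * s * (g / 8) + g * s / (16 * M) * M := by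
    calc I ≤ ∫ t, (u t + (Icc (-s) s).indicator (fun _ => g / 8) t +
          N.indicator (fun _ => (M : ℝ)) t) :=
          integral_mono_ae hpos_int ((hu_int.add i1).add i2) hae
      _ = (∫ t, u t) + 2 * s * (g / 8) + volume.real N * M := by
          rw [integral_add (f := fun t => u t + (Icc (-s) s).indicator (fun _ => g / 8) t)
              (hu_int.add i1) i2, integral_add hu_int i1,
            integral_indicator measurableSet_Icc, integral_indicator hNm, setIntegral_const,
            setIntegral_const, Real.volume_real_Icc_of_le (by linarith), smul_eq_mul, smul_eq_mul]
          ring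
      _ ≤ _ := by gcongr
  have : g * s / (16 * M) * M = g * s / 16 := by field_simp
  rw [this] at hfinal
  linarith

/-! ### Wedges and the derivative gained on a detour -/

section Detour
variable {E : Type*} [NormedAddCommGroup E] [InnerProductSpace ℝ E]

theorem norm_sub_inner_smul_le {e : E} (he : ‖e‖ = 1) (h : E) : ‖h - ⟪h, e⟫ • e‖ ≤ ‖h‖ := by
  refine le_of_sq_le_sq ?_ (norm_nonneg _)
  rw [norm_sub_sq_real, norm_smul, he, inner_smul_right, Real.norm_eq_abs, mul_one, sq_abs]
  nlinarith [sq_nonneg (⟪h, e⟫)]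

/-- The velocity of an almost straight segment, parametrized by its component along `e`. -/
theorem velocity_estimates {e h z : E} (he : ‖e‖ = 1) {κ η s : ℝ} (hs : 0 < s) (hκ : 0 < κ)
    (hκ4 : κ ≤ 1 / 4) (hη : 4 * η ≤ κ ^ 2) (hh : ‖h‖ = κ * s)
    (hz : ‖z - (s • e + h)‖ ≤ 2 * η * s) :
    3 / 4 * s ≤ s + ⟪h, e⟫ ∧ ‖(s + ⟪h, e⟫)⁻¹ • z - e‖ ≤ 3 * κ ∧
      |‖(s + ⟪h, e⟫)⁻¹ • z‖ - 1| ≤ 3 * κ ^ 2 := by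
  have hinner : |⟪h, e⟫| ≤ κ * s := by
    simpa [he, hh] using abs_real_inner_le_norm h e
  have hl : 3 / 4 * s ≤ s + ⟪h, e⟫ := by nlinarith [(abs_le.1 hinner).1]
  have hl0 : 0 < s + ⟪h, e⟫ := by linarith
  have hinv : (s + ⟪h, e⟫)⁻¹ ≤ 4 / (3 * s) := by
    rw [inv_le_comm₀ hl0 (by positivity)]
    rw [show (4 / (3 * s))⁻¹ = 3 / 4 * s by field_simp]
    exact hl
  set q := h - ⟪h, e⟫ • e with hq
  set l := s + ⟪h, e⟫ with hldef
  have hqn : ‖q‖ ≤ κ * s := hh ▸ norm_sub_inner_smul_le he h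
  have hqe : ⟪e, q⟫ = 0 := by
    rw [hq, inner_sub_right, inner_smul_right, real_inner_self_eq_norm_sq, he, real_inner_comm]
    ring
  have hw0 : l⁻¹ • (s • e + h) = e + l⁻¹ • q := by
    have : s • e + h = l • e + q := by
      rw [hq, hldef, add_smul]; abel
    rw [this, smul_add, inv_smul_smul₀ hl0.ne']
  have hpn : ‖l⁻¹ • q‖ ≤ 4 / 3 * κ := by
    rw [norm_smul, Real.norm_eq_abs, abs_of_pos (inv_pos.2 hl0)]
    calc l⁻¹ * ‖q‖ ≤ 4 / (3 * s) * (κ * s) := by gcongr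
      _ = 4 / 3 * κ := by field_simp
  have hdiff : ‖l⁻¹ • z - (e + l⁻¹ • q)‖ ≤ 2 / 3 * κ ^ 2 := by
    rw [← hw0, ← smul_sub, norm_smul, Real.norm_eq_abs, abs_of_pos (inv_pos.2 hl0)]
    have hηs : 2 * η * s ≤ κ ^ 2 / 2 * s := by nlinarith
    calc l⁻¹ * ‖z - (s • e + h)‖ ≤ 4 / (3 * s) * (κ ^ 2 / 2 * s) := by
          gcongr; exact hz.trans hηs
      _ = 2 / 3 * κ ^ 2 := by field_simp; norm_num
  -- Since `q` is orthogonal to `e`, the direction changes to first order in `κ` but the length only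
  -- to second order. The later gain in derivative depends on this.
  have hsq : ‖e + l⁻¹ • q‖ ^ 2 = 1 + ‖l⁻¹ • q‖ ^ 2 := by
    rw [norm_add_sq_real, he, inner_smul_right, hqe]; ring
  have hp0 := norm_nonneg (l⁻¹ • q)
  have hw0n := norm_nonneg (e + l⁻¹ • q)
  refine ⟨hl, ?_, ?_⟩
  · have : l⁻¹ • z - e = (l⁻¹ • z - (e + l⁻¹ • q)) + l⁻¹ • q := by abel
    rw [this]
    refine (norm_add_le _ _).trans ?_
    nlinarith
  · have h1 := abs_norm_sub_norm_le (l⁻¹ • z) (e + l⁻¹ • q)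
    have h2 : |‖e + l⁻¹ • q‖ - 1| ≤ κ ^ 2 := by
      rw [abs_le]; constructor <;> nlinarith
    calc |‖l⁻¹ • z‖ - 1| ≤ |‖l⁻¹ • z‖ - ‖e + l⁻¹ • q‖| + |‖e + l⁻¹ • q‖ - 1| :=
          abs_sub_le _ _ _
      _ ≤ 3 * κ ^ 2 := by nlinarith [sq_nonneg κ]

/-- The two-segment path with vertex `c`, reached at time `ξ`, and velocities `w₁`, `w₂`. -/
def wedgePath (c w₁ w₂ : E) (ξ t : ℝ) : E := c + min (t - ξ) 0 • w₁ + max (t - ξ) 0 • w₂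

theorem wedgePath_of_le {c w₁ w₂ : E} {ξ t : ℝ} (h : t ≤ ξ) :
    wedgePath c w₁ w₂ ξ t = c + (t - ξ) • w₁ := by
  simp [wedgePath, min_eq_left (sub_nonpos.2 h), max_eq_right (sub_nonpos.2 h)]

theorem wedgePath_of_ge {c w₁ w₂ : E} {ξ t : ℝ} (h : ξ ≤ t) :
    wedgePath c w₁ w₂ ξ t = c + (t - ξ) • w₂ := by
  simp [wedgePath, min_eq_right (sub_nonneg.2 h), max_eq_left (sub_nonneg.2 h)]

/-- The times spent on the two legs add up to the elapsed time, so the bound for each velocity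
passes across the vertex without loss. -/
theorem norm_wedgePath_sub_sub_le {c w₁ w₂ e : E} {ξ k : ℝ} (h₁ : ‖w₁ - e‖ ≤ k)
    (h₂ : ‖w₂ - e‖ ≤ k) (t t' : ℝ) :
    ‖wedgePath c w₁ w₂ ξ t - wedgePath c w₁ w₂ ξ t' - (t - t') • e‖ ≤ k * |t - t'| := by
  have hmm : ∀ r : ℝ, r = min (r - ξ) 0 + max (r - ξ) 0 + ξ := fun r => by
    rw [min_add_max]; ring
  have key : wedgePath c w₁ w₂ ξ t - wedgePath c w₁ w₂ ξ t' - (t - t') • e =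
      (min (t - ξ) 0 - min (t' - ξ) 0) • (w₁ - e) +
        (max (t - ξ) 0 - max (t' - ξ) 0) • (w₂ - e) := by
    have : t - t' = (min (t - ξ) 0 - min (t' - ξ) 0) + (max (t - ξ) 0 - max (t' - ξ) 0) := by
      linarith [hmm t, hmm t']
    rw [this, wedgePath, wedgePath]
    module
  rw [key]
  have hsum : |min (t - ξ) 0 - min (t' - ξ) 0| + |max (t - ξ) 0 - max (t' - ξ) 0| = |t - t'| := by
    rcases le_total t ξ with h | h <;> rcases le_total t' ξ with h' | h' <;>
      simp only [min_eq_left, min_eq_right, max_eq_left, max_eq_right, sub_nonpos, sub_nonneg, h, h']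
    · simp
    · rw [abs_of_nonpos (by linarith), abs_of_nonpos (by linarith), abs_of_nonpos (by linarith)]
      ring
    · rw [abs_of_nonneg (by linarith), abs_of_nonneg (by linarith), abs_of_nonneg (by linarith)]
      ring
    · simp
  refine (norm_add_le _ _).trans ?_
  rw [norm_smul, norm_smul, Real.norm_eq_abs, Real.norm_eq_abs, ← hsum, mul_add]
  nlinarith [abs_nonneg (min (t - ξ) 0 - min (t' - ξ) 0),
    abs_nonneg (max (t - ξ) 0 - max (t' - ξ) 0)]

theorem HasLineDerivAt.of_wedgePath {F : E → ℝ} {c w₁ w₂ : E} {ξ τ m : ℝ} (hτ : τ ≠ ξ)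
    (h : HasDerivAt (fun t => F (wedgePath c w₁ w₂ ξ t)) m τ) :
    HasLineDerivAt ℝ F m (wedgePath c w₁ w₂ ξ τ) (if τ < ξ then w₁ else w₂) := by
  have hshift : HasDerivAt (fun t => F (wedgePath c w₁ w₂ ξ (τ + t))) m 0 := by
    have : HasDerivAt (fun t => F (wedgePath c w₁ w₂ ξ t)) m (τ + 0) := by simpa using h
    exact this.comp_const_add τ 0
  refine hshift.congr_of_eventuallyEq ?_
  rcases lt_or_gt_of_ne hτ with h1 | h1
  · rw [if_pos h1]
    filter_upwards [Iio_mem_nhds (show (0 : ℝ) < ξ - τ by linarith)] with t ht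
    rw [wedgePath_of_le h1.le, wedgePath_of_le (by linarith [mem_Iio.1 ht])]
    congr 1
    module
  · rw [if_neg h1.not_gt]
    filter_upwards [Ioi_mem_nhds (show ξ - τ < (0 : ℝ) by linarith)] with t ht
    rw [wedgePath_of_ge h1.le, wedgePath_of_ge (by linarith [mem_Ioi.1 ht])]
    congr 1
    module

theorem wedgePath_mem_segment_left {a c w₂ : E} {ξ l t : ℝ} (hl : 0 < l)
    (ht : ξ - l ≤ t) (htξ : t ≤ ξ) : wedgePath c (l⁻¹ • (c - a)) w₂ ξ t ∈ segment ℝ a c := by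
  rw [wedgePath_of_le htξ]
  refine ⟨(ξ - t) / l, 1 - (ξ - t) / l, div_nonneg (by linarith) hl.le, ?_, by ring, ?_⟩
  · rw [sub_nonneg, div_le_one hl]; linarith
  · rw [div_eq_mul_inv]; module

theorem wedgePath_mem_segment_right {b c w₁ : E} {ξ l t : ℝ} (hl : 0 < l)
    (ht : t ≤ ξ + l) (htξ : ξ ≤ t) : wedgePath c w₁ (l⁻¹ • (b - c)) ξ t ∈ segment ℝ c b := by
  rw [wedgePath_of_ge htξ]
  refine ⟨1 - (t - ξ) / l, (t - ξ) / l, ?_, div_nonneg (by linarith) hl.le, by ring, ?_⟩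
  · rw [sub_nonneg, div_le_one hl]; linarith
  · rw [div_eq_mul_inv]; module

end Detour

theorem LipschitzWith.abs_sub_le {E : Type*} [SeminormedAddCommGroup E] {L : ℝ≥0}
    {F : E → ℝ} (hF : LipschitzWith L F) (y z : E) : |F y - F z| ≤ L * ‖y - z‖ := by
  simpa [dist_eq_norm] using hF.dist_le_mul y z

section Detour
variable {E : Type*} [NormedAddCommGroup E] [InnerProductSpace ℝ E]

/-- A Lipschitz function on `[-s, s]` that is small at the end points and large at `ξ` has, away
from the end points and from `ξ`, a point with large derivative and controlled increments. -/
theorem LipschitzWith.exists_hasDerivAt_ge_of_detour {M : ℝ≥0} {G : ℝ → ℝ}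
    (hG : LipschitzWith M G) (hM : 0 < M) {s g ξ β : ℝ} (hs : 0 < s) (hg : 0 < g)
    (hξ : ξ ∈ Icc (-s) s) (hdet : g * s ≤ |G ξ - G (-s)|)
    (hends : |G s - G (-s)| ≤ |G ξ - G (-s)| / 2) (hβ0 : 0 ≤ β) (hβ : 32 * M * β ≤ g) :
    ∃ τ m, τ ∈ Ioo (-s + β * s) (s - β * s) ∧ τ ≠ ξ ∧ HasDerivAt G m τ ∧ g / 8 ≤ m ∧
      ∀ t ∈ Icc (-s) s, |G t - G τ| ≤ 120 * √M * √m * |t - τ| := by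
  have hM' : (0 : ℝ) < M := hM
  set cl : ℝ → ℝ := fun t => max (-s) (min s t) with hcl
  have hcl_lip : LipschitzWith 1 cl := (LipschitzWith.id.const_min s).const_max (-s)
  have hcl_id : ∀ t ∈ Icc (-s) s, cl t = t := fun t ht => by
    simp only [hcl]; rw [min_eq_right ht.2, max_eq_right ht.1]
  have hφlip : LipschitzWith M (G ∘ cl) := by simpa using hG.comp hcl_lip
  have hφG : ∀ t ∈ Icc (-s) s, (G ∘ cl) t = G t := fun t ht => by
    rw [Function.comp_apply, hcl_id t ht]
  have hmem1 : -s ∈ Icc (-s) s := ⟨le_rfl, by linarith⟩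
  have hmem2 : s ∈ Icc (-s) s := ⟨by linarith, le_rfl⟩
  have hβs : 0 ≤ β * s := mul_nonneg hβ0 hs.le
  -- The exceptional set removes the vertex, where the path has a corner, and two end strips of
  -- total length `2 β s`; the bound on `β` is what makes this small enough.
  set N : Set ℝ := (Icc (-s) (-s + β * s) ∪ Icc (s - β * s) s) ∪ {ξ} with hN
  obtain ⟨τ, ⟨hτ, hτN⟩, hτd, hm, hinc⟩ := hφlip.exists_deriv_ge_and_increments_le hM hs hg
    (fun t ht => by
      rw [Function.comp_apply, Function.comp_apply, hcl_id _ hmem1]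
      simp only [hcl]
      rw [min_eq_right (by linarith), max_eq_left ht])
    (fun t ht => by
      rw [Function.comp_apply, Function.comp_apply, hcl_id _ hmem2]
      simp only [hcl]
      rw [min_eq_left ht, max_eq_right (by linarith)])
    hξ (by rwa [hφG _ hξ, hφG _ hmem1])
    (by rwa [hφG _ hξ, hφG _ hmem1, hφG _ hmem2]) (N := N)
    ((measurableSet_Icc.union measurableSet_Icc).union (measurableSet_singleton _)) (by
      refine (measure_union_le _ _).trans ?_
      rw [Real.volume_singleton, add_zero]
      refine (measure_union_le _ _).trans ?_
      rw [Real.volume_Icc, Real.volume_Icc,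
        ← ENNReal.ofReal_add (by linarith) (by linarith)]
      refine ENNReal.ofReal_le_ofReal ?_
      rw [le_div_iff₀ (by positivity)]
      have := mul_le_mul_of_nonneg_right hβ hs.le
      linarith)
  have hτIcc : τ ∈ Icc (-s) s := Ioo_subset_Icc_self hτ
  refine ⟨τ, deriv (G ∘ cl) τ, ⟨?_, ?_⟩, fun h0 => hτN (Or.inr h0), ?_, hm, fun t ht => ?_⟩
  · by_contra hcon
    exact hτN (Or.inl (Or.inl ⟨hτ.1.le, not_lt.1 hcon⟩))
  · by_contra hcon
    exact hτN (Or.inl (Or.inr ⟨not_lt.1 hcon, hτ.2.le⟩))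
  · refine hτd.hasDerivAt.congr_of_eventuallyEq ?_
    filter_upwards [Icc_mem_nhds hτ.1 hτ.2] with t ht
    exact (hφG t ht).symm
  · have := hinc (t - τ)
    rwa [add_sub_cancel, hφG t ht, hφG τ hτIcc] at this

/-- Control of the increments of `F` along a path close to a line gives control of the increments
along that line. -/
theorem LipschitzWith.increments_le_of_path {L : ℝ≥0} {F : E → ℝ} (hF : LipschitzWith L F)
    {x e : E} {γ : ℝ → E} {P κ η ν s ρ β τ K : ℝ} (hs : 0 < s) (hκ : 0 < κ) (hν0 : 0 ≤ ν)
    (hsρ : 2 * s < ρ)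
    (hline : ∀ t, |t| < ρ → |F (x + t • e) - F x - P * t| ≤ ν * |t|)
    (hγdiff : ∀ t t', ‖γ t - γ t' - (t - t') • e‖ ≤ 3 * κ * |t - t'|)
    (ha : ‖γ (-s) - (x - s • e)‖ ≤ η * s) (hb : ‖γ s - (x + s • e)‖ ≤ η * s)
    (hGa : |F (γ (-s)) - F x - P * (-s)| ≤ (ν + L * η) * s)
    (hGb : |F (γ s) - F x - P * s| ≤ (ν + L * η) * s)
    (hβ0 : 0 ≤ β) (hτ : τ ∈ Ioo (-s + β * s) (s - β * s))
    (hsmall : 2 * (L * η) + 2 * ν ≤ 4 / 5 * (L * κ * β)) (hν : ν ≤ 1 / 5 * (L * κ))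
    (hK : 4 * (L * κ) ≤ K)
    (hinc : ∀ t ∈ Icc (-s) s,
      |(F (γ t) - F x - P * t) - (F (γ τ) - F x - P * τ)| ≤ K * |t - τ|)
    {t : ℝ} (ht : |t| < ρ / 2) : |F (γ τ + t • e) - F (γ τ) - P * t| ≤ 2 * K * |t| := by
  have hL0 : (0 : ℝ) ≤ L := L.2
  have hLκ : 0 ≤ L * κ := mul_nonneg hL0 hκ.le
  have hβs : 0 ≤ β * s := mul_nonneg hβ0 hs.le
  have hK0 : 0 ≤ K := by linarith
  have ht0 := abs_nonneg t
  have hKt : 4 * (L * κ) * |t| ≤ K * |t| := mul_le_mul_of_nonneg_right hK ht0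
  have hτIcc : τ ∈ Icc (-s) s := ⟨by linarith [hτ.1], by linarith [hτ.2]⟩
  -- When `τ + t` leaves `[-s, s]` through the end `σ`, the comparison is made with the line through
  -- `x`. The distance `β s` of `τ` from the ends gives `β s ≤ |t|`, so errors proportional to `s`
  -- are absorbed into multiples of `|t|`.
  have hfar : ∀ σ, |σ| = s → |σ - τ| ≤ |t| → β * s ≤ |t| →
      ‖γ σ - (x + σ • e)‖ ≤ η * s → |F (γ σ) - F x - P * σ| ≤ (ν + L * η) * s →
      |F (γ τ + t • e) - F (γ τ) - P * t| ≤ 2 * K * |t| := by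
    intro σ hσs hσt hβt hcl hGσ
    have hclose : ‖γ τ - (x + τ • e)‖ ≤ 3 * κ * |t| + η * s := by
      have h1 := hγdiff τ σ
      rw [abs_sub_comm] at h1
      have : γ τ - (x + τ • e) = (γ τ - γ σ - (τ - σ) • e) + (γ σ - (x + σ • e)) := by module
      rw [this]
      refine (norm_add_le _ _).trans (add_le_add (h1.trans ?_) hcl)
      exact mul_le_mul_of_nonneg_left hσt (by linarith)
    have hφτ : |F (γ τ) - F x - P * τ| ≤ K * |t| + (ν + L * η) * s := by
      have h1 := hinc σ (abs_le.1 hσs.le)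
      have h2 := mul_le_mul_of_nonneg_left hσt hK0
      have h3 := abs_sub_abs_le_abs_sub (F (γ τ) - F x - P * τ) (F (γ σ) - F x - P * σ)
      rw [abs_sub_comm (F (γ τ) - F x - P * τ)] at h3
      linarith
    have h1 := hF.abs_sub_le (γ τ + t • e) (x + (τ + t) • e)
    rw [show γ τ + t • e - (x + (τ + t) • e) = γ τ - (x + τ • e) by module] at h1
    have hτs : |τ| ≤ s := abs_le.2 hτIcc
    have habs : |τ + t| ≤ s + |t| := (abs_add_le _ _).trans (by linarith)
    have h2 := hline (τ + t) (by linarith)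
    have h3 : F (γ τ + t • e) - F (γ τ) - P * t = (F (γ τ + t • e) - F (x + (τ + t) • e)) +
        (F (x + (τ + t) • e) - F x - P * (τ + t)) - (F (γ τ) - F x - P * τ) := by ring
    rw [h3]
    refine (abs_sub _ _).trans ((add_le_add_left (abs_add_le _ _) _).trans ?_)
    have h4 := mul_le_mul_of_nonneg_left habs hν0
    have h5 := mul_le_mul_of_nonneg_left hclose hL0
    have h6 := mul_le_mul_of_nonneg_right hsmall hs.le
    have h7 := mul_le_mul_of_nonneg_right hν ht0
    have h8 := mul_le_mul_of_nonneg_left hβt hLκ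
    linarith
  by_cases hin : τ + t ∈ Icc (-s) s
  · have h1 := hinc _ hin
    have h2 := hF.abs_sub_le (γ τ + t • e) (γ (τ + t))
    have h3 := hγdiff (τ + t) τ
    rw [add_sub_cancel_left] at h1 h3
    rw [← norm_neg, show -(γ (τ + t) - γ τ - t • e) = γ τ + t • e - γ (τ + t) by abel] at h3
    have h4 : F (γ τ + t • e) - F (γ τ) - P * t = (F (γ τ + t • e) - F (γ (τ + t))) +
        ((F (γ (τ + t)) - F x - P * (τ + t)) - (F (γ τ) - F x - P * τ)) := by ring
    rw [h4]
    refine (abs_add_le _ _).trans ?_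
    have h5 := mul_le_mul_of_nonneg_left h3 hL0
    have h6 := mul_nonneg hLκ ht0
    linarith
  · rw [mem_Icc, not_and_or, not_le, not_le] at hin
    rcases hin with hin | hin
    · have hte : |t| = -t := abs_of_neg (by linarith [hτIcc.1])
      refine hfar (-s) (by rw [abs_neg, abs_of_pos hs]) ?_ (by linarith [hτ.1]) ?_ hGa
      · rw [hte, abs_of_nonpos (by linarith [hτIcc.1])]; linarith
      · rwa [neg_smul, ← sub_eq_add_neg]
    · have hte : |t| = t := abs_of_pos (by linarith [hτIcc.2])
      refine hfar s (abs_of_pos hs) ?_ (by linarith [hτ.2]) hb hGb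
      rw [hte, abs_of_nonneg (by linarith [hτIcc.2])]; linarith

/-- The speed of the path is at most 2, and the subtracted linear term contributes one more `L`. -/
theorem LipschitzWith.comp_path_sub_linear {L : ℝ≥0} {F : E → ℝ} (hF : LipschitzWith L F)
    {x e : E} (he : ‖e‖ = 1) {γ : ℝ → E} {P k : ℝ} (hP : |P| ≤ L) (hk : k ≤ 1)
    (hγdiff : ∀ t t', ‖γ t - γ t' - (t - t') • e‖ ≤ k * |t - t'|) :
    LipschitzWith (3 * L) fun t => F (γ t) - F x - P * t := by
  refine LipschitzWith.of_dist_le_mul fun t t' => ?_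
  rw [Real.dist_eq, Real.dist_eq]
  push_cast
  have h0 := abs_nonneg (t - t')
  have h1 : ‖γ t - γ t'‖ ≤ 2 * |t - t'| := by
    have : γ t - γ t' = (γ t - γ t' - (t - t') • e) + (t - t') • e := by abel
    rw [this]
    refine (norm_add_le _ _).trans ?_
    rw [norm_smul, he, Real.norm_eq_abs]
    have := mul_le_mul_of_nonneg_right hk h0
    linarith [hγdiff t t']
  have h2 := hF.abs_sub_le (γ t) (γ t')
  have h3 : |P * (t - t')| ≤ L * |t - t'| := by
    rw [abs_mul]; gcongr
  have h4 := mul_le_mul_of_nonneg_left h1 L.2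
  have h5 : F (γ t) - F x - P * t - (F (γ t') - F x - P * t') =
      (F (γ t) - F (γ t')) - P * (t - t') := by ring
  rw [h5]
  refine (abs_sub _ _).trans ?_
  change (L : ℝ) * _ ≤ (L : ℝ) * _ at h4
  linarith

/-- If `F` deviates at `x + h` from the linear function with slope `P` along `e`, then on any
wedge close to the one through `x - s • e`, `x + h`, `x + s • e` there is a point with a direction
in which the derivative of `F` exceeds `P`, and with controlled increments along `e`. -/
theorem LipschitzWith.exists_lineDeriv_gt_of_detour {L : ℝ≥0} {F : E → ℝ}
    (hF : LipschitzWith L F) (hL : 0 < L) {x e h a b c : E} (he : ‖e‖ = 1)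
    {P ε κ η ν s ρ : ℝ} (hP : |P| ≤ L) (hs : 0 < s) (hε : 0 < ε) (hεL : ε ≤ L) (hκ : 0 < κ)
    (hκ4 : κ ≤ 1 / 4) (hκε : 96 * L * κ ≤ ε) (hη : 4 * η ≤ κ ^ 2)
    (hLη : L * η ≤ ε * κ ^ 2 / 960) (hν0 : 0 ≤ ν) (hν : ν ≤ ε * κ ^ 2 / 960) (hsρ : 2 * s < ρ)
    (hline : ∀ t, |t| < ρ → |F (x + t • e) - F x - P * t| ≤ ν * |t|)
    (hh : ‖h‖ = κ * s) (hdev : ε * (κ * s) ≤ |F (x + h) - F x - P * ⟪h, e⟫|)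
    (ha : ‖a - (x - s • e)‖ ≤ η * s) (hb : ‖b - (x + s • e)‖ ≤ η * s)
    (hc : ‖c - (x + h)‖ ≤ η * s) :
    ∃ x' ∈ segment ℝ a c ∪ segment ℝ c b, ∃ e' P', ‖x' - x‖ ≤ 3 * s ∧ ‖e'‖ = 1 ∧
      HasLineDerivAt ℝ F P' x' e' ∧ ε * κ / 32 ≤ P' - P ∧
      ∀ t, |t| < ρ / 2 →
        |F (x' + t • e) - F x' - P * t| ≤ 360 * √(3 * L) * √(P' - P) * |t| := by
  have hL' : (0 : ℝ) < L := hL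
  have hκ2 : κ ^ 2 ≤ κ / 4 := by nlinarith only [hκ, hκ4]
  have hξs : |⟪h, e⟫| ≤ κ * s := by simpa [he, hh] using abs_real_inner_le_norm h e
  have hl₁ := velocity_estimates (z := c - a) he hs hκ hκ4 hη hh (by
    have : c - a - (s • e + h) = (c - (x + h)) - (a - (x - s • e)) := by abel
    rw [this]; refine (_root_.norm_sub_le _ _).trans ?_; linarith)
  have hl₂ := velocity_estimates (h := -h) (z := b - c) he hs hκ hκ4 hη
    (by rw [norm_neg, hh]) (by
    have : b - c - (s • e + -h) = (b - (x + s • e)) - (c - (x + h)) := by abel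
    rw [this]; refine (_root_.norm_sub_le _ _).trans ?_; linarith)
  rw [inner_neg_left, ← sub_eq_add_neg] at hl₂
  generalize ⟪h, e⟫ = ξ at *
  obtain ⟨hl₁, hw₁, hn₁⟩ := hl₁
  obtain ⟨hl₂, hw₂, hn₂⟩ := hl₂
  obtain ⟨hξ1, hξ2⟩ := abs_le.1 hξs
  have hκs : κ * s ≤ 1 / 4 * s := mul_le_mul_of_nonneg_right hκ4 hs.le
  obtain ⟨w₁, hw₁def⟩ : ∃ w, w = (s + ξ)⁻¹ • (c - a) := ⟨_, rfl⟩
  obtain ⟨w₂, hw₂def⟩ : ∃ w, w = (s - ξ)⁻¹ • (b - c) := ⟨_, rfl⟩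
  rw [← hw₁def] at hw₁ hn₁
  rw [← hw₂def] at hw₂ hn₂
  obtain ⟨γ, hγ⟩ : ∃ γ, γ = wedgePath c w₁ w₂ ξ := ⟨_, rfl⟩
  have hγdiff : ∀ t t', ‖γ t - γ t' - (t - t') • e‖ ≤ 3 * κ * |t - t'| :=
    hγ ▸ norm_wedgePath_sub_sub_le hw₁ hw₂
  have hγa : γ (-s) = a := by
    rw [hγ, wedgePath_of_le (by linarith), hw₁def, smul_smul,
      show (-s - ξ) * (s + ξ)⁻¹ = -1 by
        have : s + ξ ≠ 0 := by linarith
        field_simp; ring]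
    module
  have hγb : γ s = b := by
    rw [hγ, wedgePath_of_ge (by linarith), hw₂def, smul_smul, mul_inv_cancel₀ (by linarith)]
    module
  have hγc : γ ξ = c := by rw [hγ, wedgePath_of_le le_rfl]; simp
  have hGlip := hF.comp_path_sub_linear (x := x) he hP (by linarith) hγdiff
  have hGa : |F (γ (-s)) - F x - P * (-s)| ≤ (ν + L * η) * s := by
    rw [hγa]
    have h1 := hF.abs_sub_le a (x - s • e)
    have h2 := hline (-s) (by rw [abs_neg, abs_of_pos hs]; linarith)
    rw [abs_neg, abs_of_pos hs, neg_smul, ← sub_eq_add_neg] at h2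
    have : F a - F x - P * -s = (F a - F (x - s • e)) + (F (x - s • e) - F x - P * -s) := by ring
    rw [this]
    refine (abs_add_le _ _).trans ?_
    have := mul_le_mul_of_nonneg_left ha hL'.le
    linarith
  have hGb : |F (γ s) - F x - P * s| ≤ (ν + L * η) * s := by
    rw [hγb]
    have h1 := hF.abs_sub_le b (x + s • e)
    have h2 := hline s (by rw [abs_of_pos hs]; linarith)
    rw [abs_of_pos hs] at h2
    have : F b - F x - P * s = (F b - F (x + s • e)) + (F (x + s • e) - F x - P * s) := by ring
    rw [this]
    refine (abs_add_le _ _).trans ?_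
    have := mul_le_mul_of_nonneg_left hb hL'.le
    linarith
  have hGc : ε * (κ * s) - L * η * s ≤ |F (γ ξ) - F x - P * ξ| := by
    rw [hγc]
    have h1 := hF.abs_sub_le c (x + h)
    have : F (x + h) - F x - P * ξ = (F c - F x - P * ξ) - (F c - F (x + h)) := by ring
    rw [this] at hdev
    have h3 := abs_sub (F c - F x - P * ξ) (F c - F (x + h))
    have := mul_le_mul_of_nonneg_left hc hL'.le
    linarith
  have hεκs : 0 < ε * κ * s := by positivity
  have hεκ2 : ε * κ ^ 2 ≤ ε * (κ / 4) := mul_le_mul_of_nonneg_left hκ2 hε.le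
  have hζ : (ν + L * η) * s ≤ ε * κ * s / 1920 := by
    have : ν + L * η ≤ ε * κ / 1920 := by linarith
    have := mul_le_mul_of_nonneg_right this hs.le
    linarith
  have hLηs : L * η * s ≤ ε * κ * s / 1920 := by
    have := mul_nonneg hν0 hs.le
    linarith
  have hdet : ε * κ / 2 * s ≤ |(F (γ ξ) - F x - P * ξ) - (F (γ (-s)) - F x - P * (-s))| := by
    have := abs_sub_abs_le_abs_sub (F (γ ξ) - F x - P * ξ) (F (γ (-s)) - F x - P * (-s))
    linarith
  have hends : |(F (γ s) - F x - P * s) - (F (γ (-s)) - F x - P * (-s))| ≤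
      |(F (γ ξ) - F x - P * ξ) - (F (γ (-s)) - F x - P * (-s))| / 2 := by
    have := abs_sub (F (γ s) - F x - P * s) (F (γ (-s)) - F x - P * (-s))
    linarith
  -- This is equality in `32 M β ≤ g` for the Lipschitz constant `M = 3 L` and the detour size `g =
  -- ε κ / 2`.
  obtain ⟨β, hβ0, hβL⟩ : ∃ β : ℝ, 0 < β ∧ 192 * (L * β) = ε * κ :=
    ⟨ε * κ / (192 * L), by positivity, by field_simp⟩
  obtain ⟨τ, m, hτ, hτξ, hderG, hm, hinc⟩ := hGlip.exists_hasDerivAt_ge_of_detour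
    (by positivity) (β := β) hs (show 0 < ε * κ / 2 by positivity)
    ⟨by linarith, by linarith⟩ hdet hends hβ0.le (by push_cast; linarith)
  have hMr : ((3 * L : ℝ≥0) : ℝ) = 3 * L := by push_cast; rfl
  rw [hMr] at hinc
  have hm0 : ε * κ / 16 ≤ m := by linarith
  have hmpos : 0 < m := lt_of_lt_of_le (by positivity) hm0
  obtain ⟨w, hw⟩ : ∃ w, w = if τ < ξ then w₁ else w₂ := ⟨_, rfl⟩
  have hwn : |‖w‖ - 1| ≤ 3 * κ ^ 2 := by
    rw [hw]; split_ifs <;> assumption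
  have hderiv : HasLineDerivAt ℝ F (m + P) (γ τ) w := by
    rw [hγ, hw]
    refine HasLineDerivAt.of_wedgePath hτξ ?_
    rw [← hγ]
    have h1 : HasDerivAt (fun t => F (γ t) - F x - P * t + P * t + F x) (m + P * 1) τ :=
      (hderG.add ((hasDerivAt_id τ).const_mul P)).add_const (F x)
    rw [mul_one] at h1
    convert h1 using 2
    ring
  have hwpos : 0 < ‖w‖ := by linarith [(abs_le.1 hwn).1]
  obtain ⟨P', hP'⟩ : ∃ P', P' = ‖w‖⁻¹ * (m + P) := ⟨_, rfl⟩
  have he' : ‖‖w‖⁻¹ • w‖ = 1 := by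
    rw [norm_smul, norm_inv, norm_norm, inv_mul_cancel₀ hwpos.ne']
  have hderiv' : HasLineDerivAt ℝ F P' (γ τ) (‖w‖⁻¹ • w) := hP' ▸ hderiv.smul ‖w‖⁻¹
  have hP'L : |P'| ≤ L := by
    simpa [he'] using hderiv'.le_of_lipschitz hF
  have hLκ : L * κ * (96 * κ) ≤ ε * κ := by
    have := mul_le_mul_of_nonneg_right hκε hκ.le
    linarith
  -- Normalizing `w` costs at most `3 L κ²`, which is at most `ε κ / 32 ≤ m / 2` by `96 L κ ≤ ε`.
  have hgap : m / 2 ≤ P' - P := by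
    have h1 : |P' * (‖w‖ - 1)| ≤ L * (3 * κ ^ 2) := by
      rw [abs_mul]; gcongr
    have h3 := (abs_le.1 h1).2
    have h4 : m + P = P' + P' * (‖w‖ - 1) := by rw [hP']; field_simp; ring
    linarith
  have hKκ : 4 * (L * κ) ≤ 120 * √(3 * L) * √m := by
    refine le_of_sq_le_sq ?_ (by positivity)
    rw [mul_pow (120 * _), mul_pow 120, Real.sq_sqrt (by positivity), Real.sq_sqrt hmpos.le]
    have h2 := mul_le_mul_of_nonneg_left hm0 hL'.le
    have h3 := mul_le_mul_of_nonneg_left hLκ hL'.le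
    have h4 : 0 < L * (ε * κ) := by positivity
    linarith
  have hKP : 2 * (120 * √(3 * L) * √m) ≤ 360 * √(3 * L) * √(P' - P) := by
    have : 2 * √m ≤ 3 * √(P' - P) := by
      refine le_of_sq_le_sq ?_ (by positivity)
      rw [mul_pow, mul_pow, Real.sq_sqrt hmpos.le, Real.sq_sqrt (by linarith)]
      linarith
    have := mul_le_mul_of_nonneg_left this (Real.sqrt_nonneg (3 * (L : ℝ)))
    linarith
  have hβs : 0 < β * s := mul_pos hβ0 hs
  have hsmall : 2 * (L * η) + 2 * ν ≤ 4 / 5 * (L * κ * β) := by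
    have := congrArg (· * κ) hβL
    linarith
  have hν5 : ν ≤ 1 / 5 * (L * κ) := by
    have h1 : ε * (κ / 4) ≤ L * (κ / 4) := by gcongr
    have h2 : 0 < L * κ := by positivity
    linarith
  refine ⟨γ τ, ?_, ‖w‖⁻¹ • w, P', ?_, he', hderiv', by linarith, fun t ht => ?_⟩
  · rcases le_total τ ξ with h1 | h1
    · left
      rw [hγ, hw₁def]
      exact wedgePath_mem_segment_left (by linarith) (by linarith [hτ.1]) h1
    · right
      rw [hγ, hw₂def]
      exact wedgePath_mem_segment_right (by linarith) (by linarith [hτ.2]) h1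
  · have h1 : |τ| ≤ s := abs_le.2 ⟨by linarith [hτ.1], by linarith [hτ.2]⟩
    have h2 := hγdiff τ ξ
    rw [hγc] at h2
    have h3 : |τ - ξ| ≤ s + s / 4 := (abs_sub _ _).trans (by linarith)
    have h4 : 3 * κ * |τ - ξ| ≤ 3 / 4 * (s + s / 4) := by gcongr; linarith
    have h5 : η * s ≤ 1 / 64 * s := by gcongr; linarith
    have : γ τ - x = (γ τ - c - (τ - ξ) • e) + (c - (x + h)) + h + (τ - ξ) • e := by abel
    rw [this]
    refine (norm_add₃_le ..).trans ?_
    have h6 := norm_add_le (γ τ - c - (τ - ξ) • e) (c - (x + h))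
    rw [norm_smul, he, mul_one, Real.norm_eq_abs, hh]
    linarith
  · refine le_trans ?_ (mul_le_mul_of_nonneg_right hKP (abs_nonneg t))
    exact hF.increments_le_of_path hs hκ hν0 hsρ hline hγdiff (by rwa [hγa]) (by rwa [hγb]) hGa hGb
      hβ0.le hτ hsmall hν5 hKκ hinc ht

end Detour

/-! ### Almost maximal directional derivatives give Fréchet differentiability -/

section Maximality
variable {E : Type*} [NormedAddCommGroup E] [InnerProductSpace ℝ E]

/-- All sufficiently small wedges around `x` can be approximated, up to any given proportion of
their size, by wedges contained in `A`. -/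
def WedgeApproximable (A : Set E) (x : E) : Prop :=
  ∀ η ∈ Ioo (0 : ℝ) 1, ∃ δ₁ : ℝ, 0 < δ₁ ∧ ∀ δ ∈ Ioo (0 : ℝ) δ₁, ∀ v₁ v₂ v₃ : E,
    ‖v₁‖ ≤ 1 → ‖v₂‖ ≤ 1 → ‖v₃‖ ≤ 1 → ∃ w₁ w₂ w₃ : E,
      ‖w₁ - v₁‖ ≤ η ∧ ‖w₂ - v₂‖ ≤ η ∧ ‖w₃ - v₃‖ ≤ η ∧
      segment ℝ (x + δ • w₁) (x + δ • w₃) ∪ segment ℝ (x + δ • w₃) (x + δ • w₂) ⊆ A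

theorem HasLineDerivAt.exists_forall_abs_le {F : E → ℝ} {P : ℝ} {x e : E}
    (h : HasLineDerivAt ℝ F P x e) {ν : ℝ} (hν : 0 < ν) :
    ∃ ρ > 0, ∀ t : ℝ, |t| < ρ → |F (x + t • e) - F x - P * t| ≤ ν * |t| := by
  have := (hasLineDerivAt_iff_isLittleO_nhds_zero.1 h).def hν
  obtain ⟨ρ, hρ, hball⟩ := Metric.eventually_nhds_iff.1 this
  refine ⟨ρ, hρ, fun t ht => ?_⟩
  have := hball (y := t) (by simpa using ht)
  simpa [mul_comm] using this

/-- A pair `(x, e)` whose directional derivative is almost locally maximal among the pairs with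
controlled increments is a point of Fréchet differentiability. -/
theorem LipschitzWith.differentiableAt_of_almost_maximal {L : ℝ≥0} {F : E → ℝ}
    (hF : LipschitzWith L F) (hL : 0 < L) {x e : E} {P : ℝ} (he : ‖e‖ = 1)
    (hPd : HasLineDerivAt ℝ F P x e)
    (hmax : ∀ g > 0, ∀ ρ > 0, ∃ δ r : ℝ, ∃ A : Set E, δ < ρ ∧ 0 < r ∧ WedgeApproximable A x ∧
      ∀ x' ∈ A, ∀ e' P', ‖x' - x‖ < r → ‖e'‖ = 1 → HasLineDerivAt ℝ F P' x' e' →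
        (∀ t, |t| < δ →
          |F (x' + t • e) - F x' - P * t| ≤ 360 * √(3 * L) * √(P' - P) * |t|) →
        P' - P < g) :
    DifferentiableAt ℝ F x := by
  have hL' : (0 : ℝ) < L := hL
  by_contra hnd
  have hnot : ¬ HasFDerivAt F (P • innerSL ℝ e) x := fun h => hnd h.differentiableAt
  rw [hasFDerivAt_iff_isLittleO_nhds_zero, Asymptotics.isLittleO_iff] at hnot
  push Not at hnot
  obtain ⟨ε₀, hε₀, hfreq⟩ := hnot
  obtain ⟨ε, hε, hεL, hεε₀⟩ : ∃ ε : ℝ, 0 < ε ∧ ε ≤ L ∧ ε ≤ ε₀ :=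
    ⟨min ε₀ L, lt_min hε₀ hL', min_le_right _ _, min_le_left _ _⟩
  -- The slope `κ` of the wedge balances the gain `ε κ` against the normalization loss `3 L κ²`. The
  -- tolerance `η` and the linearity error `ν` are then of order `ε κ²`, so as to be absorbed over
  -- the end strips.
  obtain ⟨κ, hκ, hκε⟩ : ∃ κ : ℝ, 0 < κ ∧ 96 * L * κ = ε :=
    ⟨ε / (96 * L), by positivity, by field_simp⟩
  have hκ96 : κ ≤ 1 / 96 := by
    have : (L : ℝ) * (96 * κ) ≤ L * 1 := by linarith
    linarith [le_of_mul_le_mul_left this hL']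
  obtain ⟨η, hη0, hLη⟩ : ∃ η : ℝ, 0 < η ∧ L * η = ε * κ ^ 2 / 960 :=
    ⟨ε * κ ^ 2 / (960 * L), by positivity, by field_simp⟩
  have hηκ : 4 * η ≤ κ ^ 2 := by
    have h1 : ε * κ ^ 2 ≤ L * κ ^ 2 := by gcongr
    have h2 : L * (960 * η) ≤ L * κ ^ 2 := by linarith
    linarith [le_of_mul_le_mul_left h2 hL']
  have hη1 : η < 1 := by nlinarith only [hηκ, hκ, hκ96]
  obtain ⟨ρ, hρ, hline⟩ := hPd.exists_forall_abs_le (ν := ε * κ ^ 2 / 960) (by positivity)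
  obtain ⟨δ, r, A, hδρ, hr, hA, hAmax⟩ := hmax (ε * κ / 32) (by positivity) (ρ / 2) (by positivity)
  obtain ⟨δ₁, hδ₁, hwedge⟩ := hA η ⟨hη0, hη1⟩
  have hb0 : 0 < κ * min (ρ / 2) (min (r / 3) δ₁) := by positivity
  obtain ⟨h, hdev, hhsmall⟩ :=
    (hfreq.and_eventually (Metric.ball_mem_nhds (0 : E) hb0)).exists
  rw [dist_zero_right] at hhsmall
  have hh0 : 0 < ‖h‖ := by
    rw [norm_pos_iff]
    rintro rfl
    simp at hdev
  obtain ⟨s, hs, hhs⟩ : ∃ s : ℝ, 0 < s ∧ ‖h‖ = κ * s :=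
    ⟨‖h‖ / κ, by positivity, by field_simp⟩
  rw [hhs] at hhsmall
  have hsmin := lt_of_mul_lt_mul_left hhsmall hκ.le
  rw [lt_min_iff, lt_min_iff] at hsmin
  obtain ⟨hs1, hs2, hs3⟩ := hsmin
  -- The wedge has ends `x ± s e` and vertex `x + h`; `A` and its scale were fixed before `h`, so
  -- `s` may be taken below that scale.
  obtain ⟨w₁, w₂, w₃, hw₁, hw₂, hw₃, hsub⟩ := hwedge s ⟨hs, hs3⟩ (-e) e (s⁻¹ • h)
    (by rw [norm_neg, he]) he.le (by
      rw [norm_smul, norm_inv, Real.norm_eq_abs, abs_of_pos hs, hhs]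
      rw [show s⁻¹ * (κ * s) = κ by field_simp]
      linarith)
  have hscale : ∀ w v : E, ‖w - v‖ ≤ η → ‖s • (w - v)‖ ≤ η * s := by
    intro w v hwv
    rw [norm_smul, Real.norm_eq_abs, abs_of_pos hs, mul_comm]
    gcongr
  obtain ⟨x', hx', e', P', hx'x, he', hder, hgap, hinc⟩ := hF.exists_lineDeriv_gt_of_detour hL
    (x := x) (h := h) (a := x + s • w₁) (b := x + s • w₂) (c := x + s • w₃) he
    (by simpa [he] using hPd.le_of_lipschitz hF) hs hε hεL hκ (by linarith) hκε.le hηκ hLη.le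
    (by positivity) le_rfl (by linarith) hline hhs (by
      have h1 : F (x + h) - F x - P * ⟪h, e⟫ = F (x + h) - F x - (P • innerSL ℝ e) h := by
        rw [real_inner_comm]; simp
      rw [h1, ← Real.norm_eq_abs, ← hhs]
      exact le_trans (by gcongr) hdev.le)
    (by
      have : x + s • w₁ - (x - s • e) = s • (w₁ - -e) := by module
      rw [this]; exact hscale _ _ hw₁)
    (by
      have : x + s • w₂ - (x + s • e) = s • (w₂ - e) := by module
      rw [this]; exact hscale _ _ hw₂)
    (by
      have : x + s • w₃ - (x + h) = s • (w₃ - s⁻¹ • h) := by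
        rw [smul_sub, smul_inv_smul₀ hs.ne']; abel
      rw [this]; exact hscale _ _ hw₃)
  have := hAmax x' (hsub hx') e' P' (by linarith) he' hder fun t ht => hinc t (by linarith)
  linarith

end Maximality

/-! ### The variational principle: nested almost maximizations -/

theorem exists_forall_le_add_of_bddAbove {α : Type*} {Z : Set α} (hZ : Z.Nonempty) {W : α → ℝ}
    (hW : BddAbove (W '' Z)) {ε : ℝ} (hε : 0 < ε) : ∃ z ∈ Z, ∀ z' ∈ Z, W z' ≤ W z + ε := by
  obtain ⟨_, ⟨z, hz, rfl⟩, hlt⟩ :=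
    exists_lt_of_lt_csSup (hZ.image W) (sub_lt_self (sSup (W '' Z)) hε)
  exact ⟨z, hz, fun z' hz' => by linarith [le_csSup hW (mem_image_of_mem W hz')]⟩

section Chain
variable {E : Type*} [NormedAddCommGroup E] [InnerProductSpace ℝ E]

/-- A stage of the maximization: a point `x` with direction `e` and directional derivative `p`,
a linear perturbation `v`, a range `i < j` of indices and two scales `δ` and `r`. -/
structure Stage (E : Type*) where
  i : ℝ
  j : ℝ
  x : E
  e : E
  v : E
  p : ℝ
  δ : ℝ
  r : ℝ

/-- The gain of the pair with direction `u` and derivative `q` over the pair of the stage, for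
the function perturbed by `s.v + σ • s.e`. -/
def Stage.gain (σ : ℝ) (s : Stage E) (u : E) (q : ℝ) : ℝ :=
  q + ⟪s.v + σ • s.e, u⟫ - (s.p + ⟪s.v + σ • s.e, s.e⟫)

/-- The pairs `(y, u)` among which the successor of the stage `s` is chosen. -/
structure Candidate (f : E → ℝ) (U : ℝ → Set E) (K σ : ℝ) (s : Stage E) (k : ℝ) (y u : E)
    (q : ℝ) : Prop where
  le_index : s.i ≤ k
  index_lt : k < s.j
  mem : y ∈ U k
  norm_eq : ‖u‖ = 1
  hasLineDerivAt : HasLineDerivAt ℝ f q y u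
  norm_sub_lt : ‖y - s.x‖ < s.r
  gain_nonneg : 0 ≤ s.gain σ u q
  increments : ∃ σ' < σ, ∀ t, |t| < s.δ →
    |f (y + t • s.e) - f y - s.p * t| ≤ (σ' + 2 * K * √(s.gain σ u q)) * |t|

/-- The admissible change of direction at tolerance `σ`. -/
noncomputable def turn (L : ℝ≥0) (σ : ℝ) : ℝ := σ / (8 * (L + 2))

/-- The precision of the maximization at tolerance `σ`. -/
noncomputable def precision (L : ℝ≥0) (σ : ℝ) : ℝ := σ * turn L σ ^ 2 / 2

/-- The pair of the stage is almost maximal among its candidates at tolerance `σ`. -/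
structure Stage.Good (f : E → ℝ) (U : ℝ → Set E) (K : ℝ) (L : ℝ≥0) (σ : ℝ) (s : Stage E) :
    Prop where
  nonneg : 0 ≤ s.i
  lt : s.i < s.j
  le_one : s.j ≤ 1
  mem : s.x ∈ U s.i
  norm_eq : ‖s.e‖ = 1
  hasLineDerivAt : HasLineDerivAt ℝ f s.p s.x s.e
  norm_v_le : ‖s.v‖ ≤ 2 - 2 * σ
  δ_pos : 0 < s.δ
  δ_le : s.δ ≤ σ
  r_pos : 0 < s.r
  r_le : s.r ≤ σ
  increments : ∀ t, |t| < s.δ → |f (s.x + t • s.e) - f s.x - s.p * t| ≤ σ / 2 * |t|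
  maximal : ∀ k y u q, Candidate f U K σ s k y u q →
    q + ⟪s.v, u⟫ ≤ s.p + ⟪s.v, s.e⟫ + precision L σ

/-- `s'` is an admissible successor of `s`: it is close to `s` and has fewer candidates. -/
structure Stage.Step (f : E → ℝ) (U : ℝ → Set E) (K : ℝ) (L : ℝ≥0) (σ : ℝ) (s s' : Stage E) :
    Prop where
  le_i : s.i ≤ s'.i
  j_lt : s'.j < s.j
  v_eq : s'.v = s.v + σ • s.e
  norm_sub_add_le : ‖s'.x - s.x‖ + 2 * s'.r ≤ s.r
  norm_e_sub_le : ‖s'.e - s.e‖ ≤ turn L σ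
  abs_p_sub_le : |s'.p - s.p| ≤ σ / 4
  candidate : ∀ k y u q, Candidate f U K (σ / 4) s' k y u q → Candidate f U K σ s k y u q

variable {f : E → ℝ} {U : ℝ → Set E} {K σ : ℝ} {L : ℝ≥0} {s s' : Stage E}

theorem turn_pos (hσ : 0 < σ) : 0 < turn L σ := by
  unfold turn; positivity

theorem turn_mul : turn L σ * (L + 2) = σ / 8 := by
  unfold turn; field_simp

theorem turn_le (hσ : 0 < σ) : turn L σ ≤ σ / 16 := by
  have h1 := turn_mul (L := L) (σ := σ)
  have h2 : 0 ≤ turn L σ * L := mul_nonneg (turn_pos hσ).le L.2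
  linarith

theorem precision_pos (hσ : 0 < σ) : 0 < precision L σ := by
  have := turn_pos (L := L) hσ
  unfold precision; positivity

theorem precision_le (hσ : 0 < σ) (hσ1 : σ ≤ 1) : precision L σ ≤ σ / 16 := by
  have h1 := turn_pos (L := L) hσ
  have h2 := turn_le (L := L) hσ
  have h3 : turn L σ ^ 2 ≤ 1 / 16 := by nlinarith only [h1, h2, hσ1]
  unfold precision
  nlinarith only [mul_le_mul_of_nonneg_left h3 hσ.le, hσ]

theorem HasLineDerivAt.abs_le_of_lipschitz (hf : LipschitzWith L f) {q : ℝ} {y u : E}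
    (hu : ‖u‖ = 1) (h : HasLineDerivAt ℝ f q y u) : |q| ≤ L := by
  simpa [hu] using h.le_of_lipschitz hf

theorem inner_le_one_of_norm_eq_one {e u : E} (he : ‖e‖ = 1) (hu : ‖u‖ = 1) : ⟪e, u⟫ ≤ 1 := by
  simpa [he, hu] using real_inner_le_norm e u

theorem Stage.gain_self : s.gain σ s.e s.p = 0 := by
  simp [Stage.gain]

/-- For unit vectors `1 - ⟪e, u⟫ = ‖u - e‖² / 2`, so adding `σ • e` to the perturbation acts as a
quadratic penalty on turning away from `e`. -/
theorem Stage.gain_eq (he : ‖s.e‖ = 1) (u : E) (q : ℝ) :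
    s.gain σ u q = (q + ⟪s.v, u⟫ - (s.p + ⟪s.v, s.e⟫)) - σ * (1 - ⟪s.e, u⟫) := by
  have : ⟪s.e, s.e⟫ = 1 := by rw [real_inner_self_eq_norm_sq, he]; norm_num
  simp only [Stage.gain, inner_add_left, real_inner_smul_left, this]
  ring

theorem Stage.Good.candidate_self (h : s.Good f U K L σ) (hσ : 0 < σ) :
    Candidate f U K σ s s.i s.x s.e s.p where
  le_index := le_rfl
  index_lt := h.lt
  mem := h.mem
  norm_eq := h.norm_eq
  hasLineDerivAt := h.hasLineDerivAt
  norm_sub_lt := by simpa using h.r_pos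
  gain_nonneg := Stage.gain_self.ge
  increments := ⟨σ / 2, by linarith, fun t ht => by
    simpa [Stage.gain_self] using h.increments t ht⟩

theorem Stage.Good.gain_le (h : s.Good f U K L σ) (hσ : 0 < σ) {k q : ℝ} {y u : E}
    (hc : Candidate f U K σ s k y u q) : s.gain σ u q ≤ precision L σ := by
  rw [Stage.gain_eq h.norm_eq]
  have h1 := h.maximal _ _ _ _ hc
  have h2 := mul_nonneg hσ.le (sub_nonneg.2 (inner_le_one_of_norm_eq_one h.norm_eq hc.norm_eq))
  linarith

/-- A candidate has nonnegative gain, while without the penalty it can win at most `precision L σ`.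
Hence `σ ‖u - e‖² / 2` is at most the precision, which is defined so that this reads `‖u - e‖ ≤ turn
L σ`. -/
theorem Stage.Good.norm_sub_le (h : s.Good f U K L σ) (hσ : 0 < σ) {k q : ℝ} {y u : E}
    (hc : Candidate f U K σ s k y u q) : ‖u - s.e‖ ≤ turn L σ := by
  have h1 := h.maximal _ _ _ _ hc
  have h2 := hc.gain_nonneg
  rw [Stage.gain_eq h.norm_eq] at h2
  have h3 : σ * (2 * (1 - ⟪s.e, u⟫)) ≤ σ * turn L σ ^ 2 := by
    have : precision L σ = σ * turn L σ ^ 2 / 2 := rfl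
    linarith
  have h4 := le_of_mul_le_mul_left h3 hσ
  refine le_of_sq_le_sq ?_ (turn_pos hσ).le
  rw [norm_sub_sq_real, hc.norm_eq, h.norm_eq, real_inner_comm]
  linarith

theorem Stage.Good.norm_v_add_le (h : s.Good f U K L σ) (hσ : 0 < σ) :
    ‖s.v + σ • s.e‖ ≤ 2 - σ := by
  refine (norm_add_le _ _).trans ?_
  rw [norm_smul, h.norm_eq, Real.norm_eq_abs, abs_of_pos hσ]
  linarith [h.norm_v_le]

theorem Stage.Good.abs_sub_le (h : s.Good f U K L σ) (hσ : 0 < σ) {k q : ℝ}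
    {y u : E} (hc : Candidate f U K σ s k y u q) :
    |q - s.p| ≤ 2 * turn L σ + precision L σ := by
  have h1 := h.gain_le hσ hc
  have h2 := hc.gain_nonneg
  have h3 := h.norm_sub_le hσ hc
  have h4 : |⟪s.v + σ • s.e, u - s.e⟫| ≤ 2 * turn L σ := by
    refine (abs_real_inner_le_norm _ _).trans ?_
    have := h.norm_v_add_le hσ
    gcongr
    linarith
  rw [inner_sub_right] at h4
  have h5 := abs_le.1 h4
  have h6 := precision_pos (L := L) hσ
  unfold Stage.gain at h1 h2
  rw [abs_le]
  constructor <;> linarith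

/-- Candidates for a suitable successor of a stage are candidates for that stage. -/
theorem Stage.Good.candidate_of_successor (hf : LipschitzWith L f) (hK : 0 ≤ K)
    (h : s.Good f U K L σ) (hσ : 0 < σ) (hσ1 : σ ≤ 1) (hi : s.i ≤ s'.i) (hj : s'.j < s.j)
    (hv : s'.v = s.v + σ • s.e) (hx : ‖s'.x - s.x‖ + 2 * s'.r ≤ s.r)
    (hs' : Candidate f U K σ s s'.i s'.x s'.e s'.p) {σ' : ℝ} (hσ' : σ' < σ)
    (hr : 0 < s'.r) (hrδ : 2 * L * s'.r ≤ (σ - σ') / 2 * s'.δ)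
    (hinc : ∀ t, |t| < s.δ →
      |f (s'.x + t • s.e) - f s'.x - s.p * t| ≤ (σ' + 2 * K * √(s.gain σ s'.e s'.p)) * |t|)
    {k q : ℝ} {y u : E} (hc : Candidate f U K (σ / 4) s' k y u q) :
    Candidate f U K σ s k y u q := by
  -- Gains add along successive stages, up to the new penalty, which only helps. Nonnegativity of
  -- gain and the square-root allowance therefore pass back to the earlier stage.
  have hg' : s'.gain (σ / 4) u q + s.gain σ s'.e s'.p ≤ s.gain σ u q := by
    rw [Stage.gain_eq hs'.norm_eq, hv]
    have := mul_nonneg (by positivity : 0 ≤ σ / 4)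
      (sub_nonneg.2 (inner_le_one_of_norm_eq_one hs'.norm_eq hc.norm_eq))
    simp only [Stage.gain]
    linarith
  have hg1 : s'.gain (σ / 4) u q ≤ s.gain σ u q := by linarith [hs'.gain_nonneg]
  have hg2 : s.gain σ s'.e s'.p ≤ s.gain σ u q := by linarith [hc.gain_nonneg]
  refine ⟨hi.trans hc.le_index, hc.index_lt.trans hj, hc.mem, hc.norm_eq, hc.hasLineDerivAt, ?_,
    hs'.gain_nonneg.trans hg2, max (σ / 2) ((σ' + σ) / 2), max_lt (by linarith) (by linarith),
    fun t ht => ?_⟩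
  · have : y - s.x = (y - s'.x) + (s'.x - s.x) := by abel
    rw [this]
    refine (norm_add_le _ _).trans_lt ?_
    linarith [hc.norm_sub_lt]
  · have ht0 := abs_nonneg t
    -- Below `s'.δ` the candidate's own control is used, at the price of changing direction and
    -- slope. From `s'.δ` on, the control at `s'.x` is transferred to `y`, the error `2 L s'.r`
    -- being paid for by the slack `σ - σ'`.
    rcases lt_or_ge |t| s'.δ with htδ | htδ
    · obtain ⟨σ'', hσ'', hinc'⟩ := hc.increments
      have h1 := hinc' t htδ
      have h2 : |f (y + t • s.e) - f (y + t • s'.e)| ≤ L * turn L σ * |t| := by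
        refine (hf.abs_sub_le _ _).trans ?_
        rw [add_sub_add_left_eq_sub, ← smul_sub, norm_smul, Real.norm_eq_abs, norm_sub_rev]
        have := mul_le_mul_of_nonneg_left (h.norm_sub_le hσ hs') (mul_nonneg L.2 ht0)
        change (L : ℝ) * |t| * _ ≤ (L : ℝ) * |t| * _ at this
        linarith
      have h3 : |(s'.p - s.p) * t| ≤ (2 * turn L σ + precision L σ) * |t| := by
        rw [abs_mul]
        exact mul_le_mul_of_nonneg_right (h.abs_sub_le hσ hs') ht0
      have h4 : f (y + t • s.e) - f y - s.p * t = (f (y + t • s.e) - f (y + t • s'.e)) +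
          (f (y + t • s'.e) - f y - s'.p * t) + (s'.p - s.p) * t := by ring
      rw [h4]
      refine (abs_add_three _ _ _).trans ?_
      have h5 : L * turn L σ + σ'' + (2 * turn L σ + precision L σ) ≤ σ / 2 := by
        have := turn_mul (L := L) (σ := σ)
        have := precision_le (L := L) hσ hσ1
        linarith
      have h6 := mul_le_mul_of_nonneg_right (h5.trans (le_max_left _ ((σ' + σ) / 2))) ht0
      have h7 : 2 * K * √(s'.gain (σ / 4) u q) * |t| ≤ 2 * K * √(s.gain σ u q) * |t| := by
        gcongr
      linarith
    · have h1 := hinc t ht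
      have h2 := hf.abs_sub_le (y + t • s.e) (s'.x + t • s.e)
      have h3 := hf.abs_sub_le s'.x y
      rw [add_sub_add_right_eq_sub] at h2
      rw [norm_sub_rev] at h3
      have h4 : (L : ℝ) * ‖y - s'.x‖ ≤ L * s'.r :=
        mul_le_mul_of_nonneg_left hc.norm_sub_lt.le L.2
      have h5 : f (y + t • s.e) - f y - s.p * t = (f (y + t • s.e) - f (s'.x + t • s.e)) +
          (f (s'.x + t • s.e) - f s'.x - s.p * t) + (f s'.x - f y) := by ring
      rw [h5]
      refine (abs_add_three _ _ _).trans ?_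
      have h6 : (σ - σ') / 2 * s'.δ ≤ (σ - σ') / 2 * |t| :=
        mul_le_mul_of_nonneg_left htδ (by linarith)
      have h7 : 2 * K * √(s.gain σ s'.e s'.p) * |t| ≤ 2 * K * √(s.gain σ u q) * |t| := by
        gcongr
      have h8 := mul_le_mul_of_nonneg_right (le_max_right (σ / 2) ((σ' + σ) / 2)) ht0
      linarith

theorem Stage.Good.exists_step (hf : LipschitzWith L f) (hK : 0 ≤ K) (h : s.Good f U K L σ)
    (hσ : 0 < σ) (hσ1 : σ ≤ 1) : ∃ s' : Stage E, s'.Good f U K L (σ / 4) ∧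
      s.Step f U K L σ s' := by
  have hσ4 : 0 < σ / 4 := by linarith
  obtain ⟨⟨k, y, u, q⟩, hc, hsup⟩ := exists_forall_le_add_of_bddAbove
    (Z := {z : ℝ × E × E × ℝ | Candidate f U K σ s z.1 z.2.1 z.2.2.1 z.2.2.2})
    (W := fun z => z.2.2.2 + ⟪s.v + σ • s.e, z.2.2.1⟫)
    ⟨(s.i, s.x, s.e, s.p), h.candidate_self hσ⟩
    (by
      refine ⟨L + 2, ?_⟩
      rintro _ ⟨⟨k, y, u, q⟩, hz, rfl⟩
      have hz' : Candidate f U K σ s k y u q := hz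
      have h1 := (abs_le.1 (hz'.hasLineDerivAt.abs_le_of_lipschitz hf hz'.norm_eq)).2
      have h2 := real_inner_le_norm (s.v + σ • s.e) u
      rw [hz'.norm_eq, mul_one] at h2
      have h3 := h.norm_v_add_le hσ
      simp only
      linarith)
    (precision_pos (L := L) hσ4)
  replace hc : Candidate f U K σ s k y u q := hc
  obtain ⟨σ', hσ', hinc⟩ := hc.increments
  obtain ⟨ρ, hρ, hder⟩ := hc.hasLineDerivAt.exists_forall_abs_le (ν := σ / 4 / 2) (by linarith)
  have hL0 : (0 : ℝ) ≤ L := L.2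
  obtain ⟨δ', hδ', hδρ, hδσ⟩ : ∃ δ' : ℝ, 0 < δ' ∧ δ' ≤ ρ ∧ δ' ≤ σ / 4 :=
    ⟨min ρ (σ / 4), lt_min hρ hσ4, min_le_left _ _, min_le_right _ _⟩
  obtain ⟨r', hr', hr1, hr2, hr3⟩ : ∃ r' : ℝ, 0 < r' ∧ ‖y - s.x‖ + 2 * r' ≤ s.r ∧ r' ≤ σ / 4 ∧
      2 * L * r' ≤ (σ - σ') / 2 * δ' := by
    have h1 : 0 < (σ - σ') / 2 * δ' := mul_pos (by linarith) hδ'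
    -- The denominator `2 L + 1` avoids a separate case for `L = 0`.
    refine ⟨min ((s.r - ‖y - s.x‖) / 2) (min (σ / 4) ((σ - σ') / 2 * δ' / (2 * L + 1))),
      lt_min (by linarith [hc.norm_sub_lt]) (lt_min hσ4 (by positivity)), ?_, ?_, ?_⟩
    · linarith [min_le_left ((s.r - ‖y - s.x‖) / 2)
        (min (σ / 4) ((σ - σ') / 2 * δ' / (2 * L + 1)))]
    · exact (min_le_right _ _).trans (min_le_left _ _)
    · have h2 : min ((s.r - ‖y - s.x‖) / 2) (min (σ / 4) ((σ - σ') / 2 * δ' / (2 * L + 1))) ≤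
          (σ - σ') / 2 * δ' / (2 * L + 1) := (min_le_right _ _).trans (min_le_right _ _)
      refine (mul_le_mul_of_nonneg_left h2 (by positivity)).trans ?_
      rw [mul_div_assoc', div_le_iff₀ (by positivity)]
      linarith
  have hnest := fun k' q' y' u' => h.candidate_of_successor (s' :=
    ⟨k, (k + s.j) / 2, y, u, s.v + σ • s.e, q, δ', r'⟩) hf hK hσ hσ1 hc.le_index
    (by dsimp only; linarith [hc.index_lt]) rfl hr1 hc hσ' hr' hr3 hinc
    (k := k') (q := q') (y := y') (u := u')
  refine ⟨⟨k, (k + s.j) / 2, y, u, s.v + σ • s.e, q, δ', r'⟩, ?_, ?_⟩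
  · refine ⟨h.nonneg.trans hc.le_index, ?_, ?_, hc.mem, hc.norm_eq, hc.hasLineDerivAt, ?_, hδ', hδσ,
      hr', hr2, fun t ht => hder t (lt_of_lt_of_le ht hδρ), fun k' y' u' q' hc' => ?_⟩
    · dsimp only; linarith [hc.index_lt]
    · dsimp only; linarith [hc.index_lt, h.le_one]
    · dsimp only; linarith [h.norm_v_add_le hσ]
    · exact hsup (k', y', u', q') (hnest _ _ _ _ hc')
  · refine ⟨hc.le_index, ?_, rfl, hr1, h.norm_sub_le hσ hc, ?_, fun k' y' u' q' hc' =>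
      hnest _ _ _ _ hc'⟩
    · dsimp only; linarith [hc.index_lt]
    · have := h.abs_sub_le hσ hc
      have := turn_le (L := L) hσ
      have := precision_le (L := L) hσ hσ1
      dsimp only
      linarith

theorem exists_stage_sequence (hf : LipschitzWith L f) (hK : 0 ≤ K) (hs : s.Good f U K L 1) :
    ∃ S : ℕ → Stage E, S 0 = s ∧ (∀ n, (S n).Good f U K L ((1 / 4) ^ n)) ∧
      ∀ n, (S n).Step f U K L ((1 / 4) ^ n) (S (n + 1)) := by
  have hstep : ∀ (n : ℕ) (s : {s : Stage E // s.Good f U K L ((1 / 4) ^ n)}),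
      ∃ s' : {s' : Stage E // s'.Good f U K L ((1 / 4) ^ (n + 1))},
        s.1.Step f U K L ((1 / 4) ^ n) s'.1 := by
    rintro n ⟨s, hs⟩
    obtain ⟨s', h1, h2⟩ := hs.exists_step hf hK (by positivity)
      (pow_le_one₀ (by norm_num) (by norm_num))
    refine ⟨⟨s', ?_⟩, h2⟩
    rwa [pow_succ, mul_one_div]
  choose next hnext using hstep
  let S : (n : ℕ) → {s : Stage E // s.Good f U K L ((1 / 4) ^ n)} := fun n =>
    Nat.rec ⟨s, by simpa using hs⟩ (fun n s => next n s) n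
  exact ⟨fun n => (S n).1, rfl, fun n => (S n).2, fun n => hnext n (S n)⟩

theorem exists_limit_of_dist_le_quarter_pow {α : Type*} [PseudoMetricSpace α] [CompleteSpace α]
    {a : ℕ → α} {C : ℝ} (h : ∀ n, dist (a n) (a (n + 1)) ≤ C * (1 / 4) ^ n) :
    ∃ l, Tendsto a atTop (𝓝 l) ∧ ∀ n, dist (a n) l ≤ 4 / 3 * C * (1 / 4) ^ n := by
  obtain ⟨l, hl⟩ := cauchySeq_tendsto_of_complete
    (cauchySeq_of_le_geometric (1 / 4) C (by norm_num) h)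
  refine ⟨l, hl, fun n => (dist_le_of_le_geometric_of_tendsto (1 / 4) C (by norm_num) h hl
    n).trans (le_of_eq ?_)⟩
  ring

/-- The variational principle: up to a small linear perturbation `v`, a Lipschitz function has
near the initial stage a pair `(x, e)` with almost locally maximal directional derivative. -/
theorem Stage.Good.exists_almost_maximal [CompleteSpace E] (hf : LipschitzWith L f) (hK : 0 ≤ K)
    (hclosed : ∀ q ∈ Icc (0 : ℝ) 1, IsClosed (U q))
    (hmono : ∀ p q : ℝ, 0 ≤ p → p ≤ q → q ≤ 1 → U p ⊆ U q) (hs : s.Good f U K L 1) :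
    ∃ x e v : E, ∃ p l : ℝ, ‖x - s.x‖ < s.r ∧ 0 ≤ l ∧ l < 1 ∧ x ∈ U l ∧ ‖e‖ = 1 ∧ ‖v‖ ≤ 2 ∧
      HasLineDerivAt ℝ f p x e ∧
      ∀ g > 0, ∀ ρ > 0, ∃ δ r ψ : ℝ, δ < ρ ∧ 0 < r ∧ 0 < ψ ∧ l + ψ < 1 ∧
        ∀ x' ∈ U (l + ψ), ∀ e' p', ‖x' - x‖ < r → ‖e'‖ = 1 → HasLineDerivAt ℝ f p' x' e' →
          (∀ t, |t| < δ → |f (x' + t • e) - f x' - p * t| ≤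
            K * √(p' + ⟪v, e'⟫ - (p + ⟪v, e⟫)) * |t|) →
          p' + ⟪v, e'⟫ - (p + ⟪v, e⟫) < g := by
  obtain ⟨S, rfl, hgood, hstep⟩ := exists_stage_sequence hf hK hs
  set σ : ℕ → ℝ := fun n => (1 / 4) ^ n with hσdef
  have hσ : ∀ n, 0 < σ n := fun n => by simp only [hσdef]; positivity
  have hσ1 : ∀ n, σ n ≤ 1 := fun n => pow_le_one₀ (by norm_num) (by norm_num)
  have hσsucc : ∀ n, σ (n + 1) = σ n / 4 := fun n => by simp only [hσdef]; rw [pow_succ]; ring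
  have hσ0 : Tendsto σ atTop (𝓝 0) :=
    tendsto_pow_atTop_nhds_zero_of_lt_one (by norm_num) (by norm_num)
  change ∀ n, (S n).Good f U K L (σ n) at hgood
  change ∀ n, (S n).Step f U K L (σ n) (S (n + 1)) at hstep
  -- Nestedness lets every earlier stage control all later pairs, and thereby the limit.
  have hcand : ∀ n m, n ≤ m →
      Candidate f U K (σ n) (S n) (S m).i (S m).x (S m).e (S m).p := by
    have key : ∀ n d, ∀ k y u q, Candidate f U K (σ (n + d)) (S (n + d)) k y u q →
        Candidate f U K (σ n) (S n) k y u q := by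
      intro n d
      induction d with
      | zero => exact fun k y u q h => h
      | succ d ih =>
        intro k y u q h
        refine ih k y u q ((hstep (n + d)).candidate k y u q ?_)
        rw [← hσsucc]
        exact h
    intro n m hnm
    obtain ⟨d, rfl⟩ := Nat.exists_eq_add_of_le hnm
    exact key n d _ _ _ _ ((hgood (n + d)).candidate_self (hσ _))
  obtain ⟨x, hx, -⟩ := exists_limit_of_dist_le_quarter_pow (a := fun n => (S n).x) (C := 1)
    (fun n => by
      rw [one_mul, dist_comm, dist_eq_norm]
      exact (hcand n (n + 1) n.le_succ).norm_sub_lt.le.trans (hgood n).r_le)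
  obtain ⟨e, he, hedist⟩ := exists_limit_of_dist_le_quarter_pow (a := fun n => (S n).e)
    (C := turn L 1) (fun n => by
      rw [dist_comm, dist_eq_norm]
      refine (hstep n).norm_e_sub_le.trans (le_of_eq ?_)
      simp only [turn, hσdef]; ring)
  obtain ⟨p, hp, hpdist⟩ := exists_limit_of_dist_le_quarter_pow (a := fun n => (S n).p)
    (C := 1 / 4) (fun n => by
      rw [dist_comm, Real.dist_eq]
      refine (hstep n).abs_p_sub_le.trans (le_of_eq ?_)
      simp only [hσdef]; ring)
  obtain ⟨v, hv, hvdist⟩ := exists_limit_of_dist_le_quarter_pow (a := fun n => (S n).v)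
    (C := 1) (fun n => by
      rw [dist_comm, dist_eq_norm, (hstep n).v_eq, add_sub_cancel_left, norm_smul,
        (hgood n).norm_eq, Real.norm_eq_abs, abs_of_pos (hσ n), mul_one, one_mul])
  have hen : ∀ n, ‖e - (S n).e‖ ≤ 4 / 3 * turn L 1 * σ n := fun n => by
    rw [← dist_eq_norm, dist_comm]; exact hedist n
  have hpn : ∀ n, |p - (S n).p| ≤ σ n / 3 := fun n => by
    rw [← Real.dist_eq, dist_comm]; exact (hpdist n).trans (le_of_eq (by ring))
  have hvn : ∀ n, ‖v - (S (n + 1)).v‖ ≤ σ n / 3 := fun n => by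
    rw [← dist_eq_norm, dist_comm]
    refine (hvdist (n + 1)).trans (le_of_eq ?_)
    change 4 / 3 * 1 * σ (n + 1) = _
    rw [hσsucc]; ring
  have hturn : turn L 1 * L + 2 * turn L 1 = 1 / 8 := by
    have := turn_mul (L := L) (σ := 1)
    linarith
  have hturn0 : 0 < turn L 1 := turn_pos one_pos
  have hturnL : 0 ≤ turn L 1 * L := mul_nonneg hturn0.le L.2
  have henorm : ‖e‖ = 1 :=
    tendsto_nhds_unique he.norm (by simp [(hgood _).norm_eq])
  have hvnorm : ‖v‖ ≤ 2 := le_of_tendsto hv.norm (Eventually.of_forall fun n => by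
    linarith [(hgood n).norm_v_le, hσ n])
  have hxr : ∀ n, ‖x - (S n).x‖ < (S n).r := by
    intro n
    have h1 : ‖x - (S (n + 1)).x‖ ≤ (S (n + 1)).r :=
      le_of_tendsto (hx.sub_const _).norm (eventually_atTop.2
        ⟨n + 1, fun m hm => (hcand (n + 1) m hm).norm_sub_lt.le⟩)
    have h2 := (hstep n).norm_sub_add_le
    have h3 := (hgood (n + 1)).r_pos
    have : x - (S n).x = (x - (S (n + 1)).x) + ((S (n + 1)).x - (S n).x) := by abel
    rw [this]
    refine (norm_add_le _ _).trans_lt ?_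
    linarith
  -- the direction may be changed from `(S n).e` to `e`
  have hchange : ∀ n (y : E) (t : ℝ),
      |(f (y + t • e) - f y - p * t) - (f (y + t • (S n).e) - f y - (S n).p * t)| ≤
        σ n / 2 * |t| := by
    intro n y t
    have ht0 := abs_nonneg t
    have h1 : |f (y + t • e) - f (y + t • (S n).e)| ≤ σ n / 6 * |t| := by
      refine (hf.abs_sub_le _ _).trans ?_
      rw [add_sub_add_left_eq_sub, ← smul_sub, norm_smul, Real.norm_eq_abs]
      have h2 : (L : ℝ) * ‖e - (S n).e‖ ≤ L * (4 / 3 * turn L 1 * σ n) :=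
        mul_le_mul_of_nonneg_left (hen n) L.2
      have h3 : turn L 1 * L * σ n ≤ 1 / 8 * σ n :=
        mul_le_mul_of_nonneg_right (by linarith) (hσ n).le
      have h4 : (L : ℝ) * ‖e - (S n).e‖ ≤ σ n / 6 := by linarith
      have := mul_le_mul_of_nonneg_right h4 ht0
      linarith
    have h2 : |(p - (S n).p) * t| ≤ σ n / 3 * |t| := by
      rw [abs_mul]; exact mul_le_mul_of_nonneg_right (hpn n) ht0
    have h3 : (f (y + t • e) - f y - p * t) - (f (y + t • (S n).e) - f y - (S n).p * t) =
        (f (y + t • e) - f (y + t • (S n).e)) - (p - (S n).p) * t := by ring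
    rw [h3]
    refine (abs_sub _ _).trans ?_
    linarith
  have hxinc : ∀ n t, |t| < (S n).δ →
      |f (x + t • e) - f x - p * t| ≤ (2 * σ n + 2 * K * √(σ n)) * |t| := by
    intro n t ht
    have ht0 := abs_nonneg t
    have h1 : |f (x + t • (S n).e) - f x - (S n).p * t| ≤ (σ n + 2 * K * √(σ n)) * |t| := by
      have hcont : Tendsto (fun m => |f ((S m).x + t • (S n).e) - f (S m).x - (S n).p * t|) atTop
          (𝓝 |f (x + t • (S n).e) - f x - (S n).p * t|) :=
        ((((hf.continuous.tendsto _).comp (hx.add_const _)).sub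
          ((hf.continuous.tendsto _).comp hx)).sub_const _).abs
      refine le_of_tendsto hcont (eventually_atTop.2 ⟨n, fun m hm => ?_⟩)
      have hc := hcand n m hm
      obtain ⟨σ', hσ', hinc⟩ := hc.increments
      have h2 : (S n).gain (σ n) (S m).e (S m).p ≤ σ n :=
        ((hgood n).gain_le (hσ n) hc).trans
          ((precision_le (hσ n) (hσ1 n)).trans (by linarith [hσ n]))
      refine (hinc t ht).trans ?_
      gcongr
    have h2 := hchange n x t
    have h3 := abs_sub_abs_le_abs_sub (f (x + t • e) - f x - p * t)
      (f (x + t • (S n).e) - f x - (S n).p * t)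
    have h4 := mul_nonneg (hσ n).le ht0
    linarith
  have hder : HasLineDerivAt ℝ f p x e := by
    rw [hasLineDerivAt_iff_isLittleO_nhds_zero, Asymptotics.isLittleO_iff]
    intro c hc
    -- The gains tend to 0, so even the square-root allowance vanishes in the limit; this is why `p`
    -- is a genuine derivative at `x`.
    have hlim : Tendsto (fun n => 2 * σ n + 2 * K * √(σ n)) atTop (𝓝 0) := by
      have h1 : Tendsto (fun n => √(σ n)) atTop (𝓝 0) := by
        have := (Real.continuous_sqrt.tendsto 0).comp hσ0
        rwa [Real.sqrt_zero] at this
      simpa using (hσ0.const_mul 2).add (h1.const_mul (2 * K))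
    obtain ⟨n, hn⟩ := (hlim.eventually (gt_mem_nhds hc)).exists
    filter_upwards [Metric.ball_mem_nhds (0 : ℝ) (hgood n).δ_pos] with t ht
    have h1 := hxinc n t (by simpa using ht)
    rw [Real.norm_eq_abs, Real.norm_eq_abs, smul_eq_mul, mul_comm t]
    exact h1.trans (mul_le_mul_of_nonneg_right hn.le (abs_nonneg t))
  have himono : Monotone fun n => (S n).i := monotone_nat_of_le_succ fun n => (hstep n).le_i
  have hjanti : Antitone fun n => (S n).j := antitone_nat_of_succ_le fun n => (hstep n).j_lt.le
  have hij : ∀ n m, (S n).i ≤ (S m).j := fun n m =>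
    (himono (le_max_left n m)).trans
      ((hgood (max n m)).lt.le.trans (hjanti (le_max_right n m)))
  obtain ⟨l, hl⟩ : ∃ l, l = ⨆ n, (S n).i := ⟨_, rfl⟩
  have hil : ∀ n, (S n).i ≤ l := fun n => by
    rw [hl]
    exact le_ciSup (f := fun n => (S n).i) ⟨(S 0).j, by rintro _ ⟨m, rfl⟩; exact hij m 0⟩ n
  -- Strict decrease of the upper indices keeps `l` below each of them, leaving room for a positive
  -- `ψ`.
  have hlj : ∀ n, l < (S n).j := fun n => by
    have : l ≤ (S (n + 1)).j := by rw [hl]; exact ciSup_le fun m => hij m _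
    exact this.trans_lt (hstep n).j_lt
  have hl0 : 0 ≤ l := (hgood 0).nonneg.trans (hil 0)
  have hl1 : l < 1 := (hlj 0).trans_le (hgood 0).le_one
  have hxU : x ∈ U l := (hclosed l ⟨hl0, hl1.le⟩).mem_of_tendsto hx (Eventually.of_forall fun n =>
    hmono _ _ (hgood n).nonneg (hil n) hl1.le (hgood n).mem)
  refine ⟨x, e, v, p, l, hxr 0, hl0, hl1, hxU, henorm, hvnorm, hder, fun g hg ρ hρ => ?_⟩
  obtain ⟨n, hng, hnρ⟩ : ∃ n, σ n < g / 8 ∧ σ n < ρ :=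
    ((hσ0.eventually (gt_mem_nhds (by positivity))).and
      (hσ0.eventually (gt_mem_nhds hρ))).exists
  refine ⟨(S n).δ, (S n).r - ‖x - (S n).x‖, ((S n).j - l) / 2, (hgood n).δ_le.trans_lt hnρ,
    sub_pos.2 (hxr n), by linarith [hlj n], by linarith [hlj n, (hgood n).le_one],
    fun x' hx' e' p' hx'x he' hder' hinc => ?_⟩
  by_contra! hcon
  -- Passing from the limit to stage `n` costs at most `2 σ n`, less than a quarter of a limit gain
  -- exceeding `8 σ n`. Hence the square root of the limit gain is at most twice that of the stage
  -- gain, which is the role of `2 * K` in `Candidate`.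
  have hgain : p' + ⟪v, e'⟫ - (p + ⟪v, e⟫) - 2 * σ n ≤ (S n).gain (σ n) e' p' := by
    have hvv : ∀ u : E, ‖u‖ = 1 → |⟪v - (S (n + 1)).v, u⟫| ≤ σ n / 3 := fun u hu => by
      refine (abs_real_inner_le_norm _ _).trans ?_
      rw [hu, mul_one]
      exact hvn n
    have h1 := (abs_le.1 (hvv e' he')).2
    have h2 := (abs_le.1 (hvv e henorm)).1
    have h3 := (abs_le.1 (hpn n)).1
    have h4 : |⟪(S (n + 1)).v, e - (S n).e⟫| ≤ σ n / 3 := by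
      refine (abs_real_inner_le_norm _ _).trans ?_
      have h5 : ‖(S (n + 1)).v‖ ≤ 2 := by linarith [(hgood (n + 1)).norm_v_le, hσ (n + 1)]
      have h6 := mul_le_mul h5 (hen n) (norm_nonneg _) (by norm_num)
      have h7 : turn L 1 * σ n ≤ 1 / 16 * σ n :=
        mul_le_mul_of_nonneg_right (by linarith) (hσ n).le
      linarith [hσ n]
    have h5 := (abs_le.1 h4).1
    have h6 := hσ n
    rw [inner_sub_left] at h1 h2
    rw [inner_sub_right] at h5
    rw [Stage.gain, ← (hstep n).v_eq]
    linarith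
  have hσn := hσ n
  have hc : Candidate f U K (σ n) (S n) (l + ((S n).j - l) / 2) x' e' p' := by
    refine ⟨by linarith [hil n, hlj n], by linarith [hlj n], hx', he', hder', ?_, by linarith,
      σ n / 2, by linarith, fun t ht => ?_⟩
    · have : x' - (S n).x = (x' - x) + (x - (S n).x) := by abel
      rw [this]
      refine (norm_add_le _ _).trans_lt ?_
      linarith
    · have h1 := hinc t ht
      have h2 := hchange n x' t
      rw [abs_sub_comm] at h2
      have h3 := abs_sub_abs_le_abs_sub (f (x' + t • (S n).e) - f x' - (S n).p * t)
        (f (x' + t • e) - f x' - p * t)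
      have h4 : √(p' + ⟪v, e'⟫ - (p + ⟪v, e⟫)) ≤ 2 * √((S n).gain (σ n) e' p') := by
        refine Real.sqrt_le_iff.2 ⟨by positivity, ?_⟩
        rw [mul_pow, Real.sq_sqrt (by linarith)]
        linarith
      have h5 : K * √(p' + ⟪v, e'⟫ - (p + ⟪v, e⟫)) * |t| ≤
          K * (2 * √((S n).gain (σ n) e' p')) * |t| := by gcongr
      linarith
  have h1 := (hgood n).gain_le (hσ n) hc
  have h2 := precision_le (L := L) (hσ n) (hσ1 n)
  linarith

end Chain

/-! ### Starting the iteration and removing the linear perturbation -/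

section Existence
variable {E : Type*} [NormedAddCommGroup E] [InnerProductSpace ℝ E]
variable {f : E → ℝ} {U : ℝ → Set E} {L : ℝ≥0}

theorem LipschitzWith.exists_hasLineDerivAt_mem_segment (hf : LipschitzWith L f) {a b : E}
    (hab : a ≠ b) : ∃ z ∈ segment ℝ a b, ∃ (e : E) (p : ℝ), ‖e‖ = 1 ∧ HasLineDerivAt ℝ f p z e := by
  have hlip : LipschitzWith (L * ‖b - a‖₊) fun t : ℝ => f (a + t • (b - a)) := by
    refine LipschitzWith.of_dist_le_mul fun t t' => ?_
    refine (hf.dist_le_mul _ _).trans (le_of_eq ?_)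
    rw [dist_eq_norm, add_sub_add_left_eq_sub, ← sub_smul, norm_smul, Real.dist_eq,
      Real.norm_eq_abs, NNReal.coe_mul, coe_nnnorm]
    ring
  obtain ⟨t, hdiff, ht⟩ := (Measure.dense_of_ae hlip.ae_differentiableAt_real).exists_mem_open
    isOpen_Ioo (nonempty_Ioo.2 (zero_lt_one (α := ℝ)))
  have hba : ‖b - a‖ ≠ 0 := norm_ne_zero_iff.2 (sub_ne_zero.2 hab.symm)
  obtain ⟨m, hm⟩ : ∃ m, HasDerivAt (fun t : ℝ => f (a + t • (b - a))) m t :=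
    ⟨_, DifferentiableAt.hasDerivAt hdiff⟩
  have hline : HasLineDerivAt ℝ f m (a + t • (b - a)) (b - a) := by
    have h1 : HasDerivAt (fun u : ℝ => f (a + (t + u) • (b - a))) m 0 := by
      have : HasDerivAt (fun t : ℝ => f (a + t • (b - a))) m (t + 0) := by simpa using hm
      exact this.comp_const_add t 0
    refine h1.congr_of_eventuallyEq (Eventually.of_forall fun u => ?_)
    dsimp only
    congr 1
    module
  refine ⟨a + t • (b - a), ?_, ‖b - a‖⁻¹ • (b - a), _, ?_, hline.smul ‖b - a‖⁻¹⟩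
  · rw [segment_eq_image']
    exact ⟨t, Ioo_subset_Icc_self ht, rfl⟩
  · rw [norm_smul, norm_inv, norm_norm, inv_mul_cancel₀ hba]

theorem WedgeApproximable.exists_hasLineDerivAt [Nontrivial E] (hf : LipschitzWith L f)
    {A : Set E} {x : E} (hA : WedgeApproximable A x) {ρ : ℝ} (hρ : 0 < ρ) :
    ∃ z ∈ A, ‖z - x‖ < ρ ∧ ∃ (e : E) (p : ℝ), ‖e‖ = 1 ∧ HasLineDerivAt ℝ f p z e := by
  obtain ⟨e, he⟩ := exists_norm_eq E zero_le_one
  obtain ⟨δ₁, hδ₁, hwedge⟩ := hA (1 / 2) ⟨by norm_num, by norm_num⟩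
  obtain ⟨δ, hδ, hδ1, hδρ⟩ : ∃ δ : ℝ, 0 < δ ∧ δ < δ₁ ∧ δ * (3 / 2) < ρ := by
    obtain ⟨δ, hδ, hlt⟩ := exists_between (lt_min hδ₁ (half_pos hρ))
    exact ⟨δ, hδ, hlt.trans_le (min_le_left _ _), by linarith [hlt.trans_le (min_le_right _ _)]⟩
  -- Opposite unit vectors moved by at most `1 / 2` each remain distinct, so the first leg is a
  -- nondegenerate segment, on which one-dimensional almost everywhere differentiability applies.
  obtain ⟨w₁, w₂, w₃, hw₁, -, hw₃, hsub⟩ := hwedge δ ⟨hδ, hδ1⟩ e 0 (-e) he.le (by simp)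
    (by rw [norm_neg, he])
  have hball : ∀ w v : E, ‖v‖ = 1 → ‖w - v‖ ≤ 1 / 2 → x + δ • w ∈ closedBall x (δ * (3 / 2)) := by
    intro w v hv hwv
    rw [mem_closedBall, dist_eq_norm, add_sub_cancel_left, norm_smul, Real.norm_eq_abs,
      abs_of_pos hδ]
    gcongr
    have := norm_add_le (w - v) v
    rw [sub_add_cancel, hv] at this
    linarith
  have hne : x + δ • w₁ ≠ x + δ • w₃ := by
    intro h
    have h1 : w₁ = w₃ := smul_right_injective E hδ.ne' (add_left_cancel h)
    have h2 : (2 : ℝ) • e = (w₃ - -e) - (w₁ - e) := by rw [h1]; module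
    have h3 := norm_sub_le (w₃ - -e) (w₁ - e)
    rw [← h2, norm_smul, he, Real.norm_two] at h3
    linarith
  obtain ⟨z, hz, e', p, he', hp⟩ := hf.exists_hasLineDerivAt_mem_segment hne
  refine ⟨z, hsub (Or.inl hz), ?_, e', p, he', hp⟩
  have := (convex_closedBall x (δ * (3 / 2))).segment_subset (hball _ _ he hw₁)
    (hball _ _ (by rw [norm_neg, he]) hw₃) hz
  rw [mem_closedBall, dist_eq_norm] at this
  linarith

theorem exists_good_stage [Nontrivial E] (hf : LipschitzWith L f) (K : ℝ)
    (happrox : ∀ l ∈ Ico (0 : ℝ) 1, ∀ ψ ∈ Ioo (0 : ℝ) (1 - l), ∀ x ∈ U l,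
      WedgeApproximable (U (l + ψ)) x)
    {q : ℝ} (hq : q ∈ Ico (0 : ℝ) 1) {y : E} (hy : y ∈ U q) {ρ : ℝ} (hρ : 0 < ρ) :
    ∃ s : Stage E, s.Good f U K L 1 ∧ ‖s.x - y‖ + s.r ≤ ρ := by
  obtain ⟨z, hz, hzy, e, p, he, hp⟩ := (happrox q hq ((1 - q) / 2)
    ⟨by linarith [hq.2], by linarith [hq.2]⟩ y hy).exists_hasLineDerivAt hf hρ
  -- The first stage starts with `v = 0` and upper index 1, almost maximizing over all directional
  -- derivatives near `y` at points of the sets with index below 1. Every later candidate lies in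
  -- this class.
  obtain ⟨⟨k, x, u, m⟩, hxu, hsup⟩ := exists_forall_le_add_of_bddAbove
    (Z := {z : ℝ × E × E × ℝ | (0 ≤ z.1 ∧ z.1 < 1) ∧ z.2.1 ∈ U z.1 ∧ ‖z.2.1 - y‖ < ρ ∧
      ‖z.2.2.1‖ = 1 ∧ HasLineDerivAt ℝ f z.2.2.2 z.2.1 z.2.2.1})
    (W := fun z => z.2.2.2)
    ⟨(q + (1 - q) / 2, z, e, p), ⟨by dsimp only; linarith [hq.1, hq.2],
      by dsimp only; linarith [hq.2]⟩, hz, hzy, he, hp⟩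
    (by
      refine ⟨L, ?_⟩
      rintro _ ⟨⟨k, x, u, m⟩, ⟨-, -, -, hu, hm⟩, rfl⟩
      exact (abs_le.1 (hm.abs_le_of_lipschitz hf hu)).2)
    (precision_pos (L := L) one_pos)
  obtain ⟨⟨hk0, hk1⟩, hx, hxy, hu, hm⟩ := hxu
  dsimp only at hk0 hk1 hx hxy hu hm
  obtain ⟨δ, hδ, hinc⟩ := hm.exists_forall_abs_le (ν := 1 / 2) (by norm_num)
  refine ⟨⟨k, 1, x, u, 0, m, min δ 1, min (ρ - ‖x - y‖) 1⟩, ⟨hk0, hk1, le_rfl, hx, hu, hm,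
    by simp, lt_min hδ one_pos, min_le_right _ _, lt_min (sub_pos.2 hxy) one_pos,
    min_le_right _ _, fun t ht => hinc t (ht.trans_le (min_le_left _ _)), ?_⟩, ?_⟩
  · intro k' x' u' m' hc
    have := hsup (k', x', u', m') ⟨⟨hk0.trans hc.le_index, hc.index_lt⟩, hc.mem, ?_, hc.norm_eq,
      hc.hasLineDerivAt⟩
    · simpa using this
    · have h1 := hc.norm_sub_lt.trans_le (min_le_left _ _)
      dsimp only at h1 ⊢
      have : x' - y = (x' - x) + (x - y) := by abel
      rw [this]
      refine (norm_add_le _ _).trans_lt ?_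
      linarith
  · have := min_le_left (ρ - ‖x - y‖) 1
    dsimp only
    linarith

theorem hasLineDerivAt_add_inner_iff {v x e : E} {p : ℝ} :
    HasLineDerivAt ℝ (fun z => f z + ⟪v, z⟫) (p + ⟪v, e⟫) x e ↔ HasLineDerivAt ℝ f p x e := by
  have hlin : HasDerivAt (fun t : ℝ => ⟪v, x + t • e⟫) ⟪v, e⟫ 0 := by
    simp only [inner_add_right, inner_smul_right]
    simpa using ((hasDerivAt_id (0 : ℝ)).mul_const ⟪v, e⟫).const_add ⟪v, x⟫
  constructor
  · intro h
    have := HasDerivAt.fun_sub h hlin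
    simpa [HasLineDerivAt] using this
  · intro h
    exact HasDerivAt.fun_add h hlin

/-- A Lipschitz function is differentiable at points arbitrarily close to any point of a set in a
family of closed sets with the wedge approximation property. -/
theorem LipschitzWith.exists_differentiableAt_near [CompleteSpace E] [Nontrivial E]
    (hf : LipschitzWith L f) (hclosed : ∀ q ∈ Icc (0 : ℝ) 1, IsClosed (U q))
    (hmono : ∀ p q : ℝ, 0 ≤ p → p ≤ q → q ≤ 1 → U p ⊆ U q)
    (happrox : ∀ l ∈ Ico (0 : ℝ) 1, ∀ ψ ∈ Ioo (0 : ℝ) (1 - l), ∀ x ∈ U l,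
      WedgeApproximable (U (l + ψ)) x)
    {q : ℝ} (hq : q ∈ Ico (0 : ℝ) 1) {y : E} (hy : y ∈ U q) {ρ : ℝ} (hρ : 0 < ρ) :
    ∃ l ∈ Ico (0 : ℝ) 1, ∃ x ∈ U l, ‖x - y‖ < ρ ∧ DifferentiableAt ℝ f x := by
  -- The perturbation satisfies `‖v‖ ≤ 2`, so `M` is a Lipschitz constant of the perturbed function.
  -- The constant of the iteration is chosen to match the `360 √(3 M)` of the maximality criterion.
  set M : ℝ≥0 := L + 2 with hM
  obtain ⟨s, hs, hsρ⟩ := exists_good_stage hf (360 * √(3 * M)) happrox hq hy hρ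
  obtain ⟨x, e, v, p, l, hxs, hl0, hl1, hxU, he, hv, hp, hmax⟩ :=
    hs.exists_almost_maximal hf (by positivity) hclosed hmono
  refine ⟨l, ⟨hl0, hl1⟩, x, hxU, ?_, ?_⟩
  · have : x - y = (x - s.x) + (s.x - y) := by abel
    rw [this]
    refine (norm_add_le _ _).trans_lt ?_
    linarith
  · have hF : LipschitzWith M fun z => f z + ⟪v, z⟫ := by
      refine hf.add (LipschitzWith.of_dist_le_mul fun z z' => ?_)
      rw [Real.dist_eq, ← inner_sub_right, dist_eq_norm]
      refine (abs_real_inner_le_norm _ _).trans ?_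
      gcongr
      exact hv
    have hd : DifferentiableAt ℝ (fun z => f z + ⟪v, z⟫) x := by
      refine hF.differentiableAt_of_almost_maximal (by rw [hM]; positivity) he
        (hasLineDerivAt_add_inner_iff.2 hp) fun g hg ρ hρ => ?_
      obtain ⟨δ, r, ψ, hδ, hr, hψ, hlψ, hle⟩ := hmax g hg ρ hρ
      refine ⟨δ, r, U (l + ψ), hδ, hr, happrox l ⟨hl0, hl1⟩ ψ ⟨hψ, by linarith⟩ x hxU,
        fun x' hx' e' P' hx'x he' hder hinc => ?_⟩
      have hP' : P' = (P' - ⟪v, e'⟫) + ⟪v, e'⟫ := by ring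
      rw [hP'] at hder
      have := hle x' hx' e' (P' - ⟪v, e'⟫) hx'x he' (hasLineDerivAt_add_inner_iff.1 hder)
        fun t ht => ?_
      · rwa [← hP'] at this
      · rw [← hP']
        convert hinc t ht using 2
        rw [inner_add_right, inner_smul_right]
        ring
    have hlin : DifferentiableAt ℝ (fun z => ⟪v, z⟫) x := (innerSL ℝ v).differentiableAt
    simpa using hd.fun_sub hlin

end Existence

theorem theorem2 (d : ℕ) (hd : 2 ≤ d) (U : ℝ → Set (EuclideanSpace ℝ (Fin d)))
    (hclosed : ∀ q ∈ Set.Icc (0 : ℝ) 1, IsClosed (U q))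
    (hmono : ∀ p q : ℝ, 0 ≤ p → p ≤ q → q ≤ 1 → U p ⊆ U q)
    (hne : ∃ q ∈ Set.Ico (0 : ℝ) 1, (U q).Nonempty)
    (happrox : ∀ l ∈ Set.Ico (0 : ℝ) 1, ∀ ψ ∈ Set.Ioo (0 : ℝ) (1 - l),
      ∀ η ∈ Set.Ioo (0 : ℝ) 1, ∃ δ₁ : ℝ, 0 < δ₁ ∧
        ∀ x ∈ U l, ∀ δ ∈ Set.Ioo (0 : ℝ) δ₁, ∀ v₁ v₂ v₃ : EuclideanSpace ℝ (Fin d),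
          ‖v₁‖ ≤ 1 → ‖v₂‖ ≤ 1 → ‖v₃‖ ≤ 1 →
          ∃ w₁ w₂ w₃ : EuclideanSpace ℝ (Fin d),
            ‖w₁ - v₁‖ ≤ η ∧ ‖w₂ - v₂‖ ≤ η ∧ ‖w₃ - v₃‖ ≤ η ∧
            segment ℝ (x + δ • w₁) (x + δ • w₃) ∪ segment ℝ (x + δ • w₃) (x + δ • w₂)
              ⊆ U (l + ψ)) :
    IsUniversalDifferentiabilitySet (closure (⋃ q ∈ Set.Ico (0 : ℝ) 1, U q)) ∧
    ∀ y ∈ closure (⋃ q ∈ Set.Ico (0 : ℝ) 1, U q), ∀ ρ : ℝ, 0 < ρ →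
      ∀ g : EuclideanSpace ℝ (Fin d) → ℝ, (∃ L : NNReal, LipschitzWith L g) →
        ∃ x ∈ closure (⋃ q ∈ Set.Ico (0 : ℝ) 1, U q),
          ‖x - y‖ < ρ ∧ DifferentiableAt ℝ g x := by
  have : Nonempty (Fin d) := ⟨⟨0, by omega⟩⟩
  have hwedge : ∀ l ∈ Ico (0 : ℝ) 1, ∀ ψ ∈ Ioo (0 : ℝ) (1 - l), ∀ x ∈ U l,
      WedgeApproximable (U (l + ψ)) x := by
    intro l hl ψ hψ x hx η hη
    obtain ⟨δ₁, hδ₁, h⟩ := happrox l hl ψ hψ η hη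
    exact ⟨δ₁, hδ₁, h x hx⟩
  have hnear : ∀ y ∈ closure (⋃ q ∈ Set.Ico (0 : ℝ) 1, U q), ∀ ρ : ℝ, 0 < ρ →
      ∀ g : EuclideanSpace ℝ (Fin d) → ℝ, (∃ L : NNReal, LipschitzWith L g) →
        ∃ x ∈ closure (⋃ q ∈ Set.Ico (0 : ℝ) 1, U q),
          ‖x - y‖ < ρ ∧ DifferentiableAt ℝ g x := by
    rintro y hy ρ hρ g ⟨L, hg⟩
    obtain ⟨z, hz, hyz⟩ := Metric.mem_closure_iff.1 hy (ρ / 2) (by positivity)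
    obtain ⟨q, hq, hzq⟩ := mem_iUnion₂.1 hz
    obtain ⟨l, hl, x, hx, hxz, hdiff⟩ :=
      hg.exists_differentiableAt_near hclosed hmono hwedge hq hzq (half_pos hρ)
    refine ⟨x, subset_closure (mem_iUnion₂.2 ⟨l, hl, hx⟩), ?_, hdiff⟩
    rw [dist_comm, dist_eq_norm] at hyz
    have : x - y = (x - z) + (z - y) := by abel
    rw [this]
    refine (norm_add_le _ _).trans_lt ?_
    linarith
  refine ⟨fun g hg => ?_, hnear⟩
  obtain ⟨q, hq, y, hy⟩ := hne
  obtain ⟨x, hx, -, hdiff⟩ :=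
    hnear y (subset_closure (mem_iUnion₂.2 ⟨q, hq, hy⟩)) 1 one_pos g hg
  exact ⟨x, hx, hdiff⟩
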